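/- Let $A$, $J$, $B$ be nonzero finite-dimensional complex Hilbert spaces, and let $\mathcal N:\mathcal L(A\otimes J)\to\mathcal L(B)$ be a completely positive trace preserving (cptp) map (a quantum arbitrarily varying channel, QAVC, with sender $A$, jammer $J$ and receiver $B$). For a block length $\ell$ and a state $\sigma$ on $J^{\otimes\ell}$ (not necessarily a product state) put $\mathcal N^{\otimes\ell}_\sigma(\rho)=\mathcal N^{\otimes\ell}(\rho\otimes\sigma)$ for $\rho\in\mathcal L(A^{\otimes\ell})$. A deterministic classical code $\mathcal C$ of block length $\ell$ and size $M$ consists of states $\rho_1,\dots,\rho_M$ on $A^{\otimes\ell}$ and operators $D_1,\dots,D_M\ge 0$ on $B^{\otimes\ell}$ with $\sum_m D_m=\mathbb 1$; its error against $\sigma$ is $$P_{\mathrm{err}}(\mathcal C,\sigma)=\frac1M\sum_{m=1}^M\operatorname{tr}\bigl(\mathcal N^{\otimes\ell}(\rho_m\otimes\sigma)(\mathbb 1-D_m)\bigr).$$ A deterministic quantum code $\mathcal Q$ of block length $\ell$ and size $L$ is a pair of cptp maps $\mathcal E:\mathcal L(\mathbb C^L)\to\mathcal L(A^{\otimes\ell})$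 and $\mathcal D:\mathcal L(B^{\otimes\ell})\to\mathcal L(\mathbb C^L)$; its infidelity against $\sigma$ is $$\widehat F(\mathcal Q,\sigma)=1-\operatorname{tr}\Bigl(\bigl((\mathrm{id}\otimes\mathcal D\circ\mathcal N^{\otimes\ell}_\sigma\circ\mathcal E)\Phi_L\bigr)\Phi_L\Bigr),\qquad \Phi_L=\frac1L\sum_{i,j}|ii\rangle\langle jj|.$$ A random classical (quantum) code of block length $\ell$ and size $M$ (resp. $L$) is a family of deterministic codes $\mathcal C_\lambda$ (resp. $\mathcal Q_\lambda$) of that block length and size indexed by a random variable $\lambda$; its error against $\sigma$ is the expectation $\mathbb E_\lambda P_{\mathrm{err}}(\mathcal C_\lambda,\sigma)$ (resp. $\mathbb E_\lambda\widehat F(\mathcal Q_\lambda,\sigma)$). Let $C_{\mathrm{det}}(\mathcal N)$ (resp. $C_{\mathrm{rand}}(\mathcal N)$) be the supremum of $\limsup_{\ell\to\infty}\frac1\ell\log_2 M_\ell$ over all sequences, indexed by $\ell$, of deterministic (resp. random) classical codes of block length $\ell$ and size $M_\ell$ whose worst-case error, the supremum over all states $\sigma$ on $J^{\otimes\ell}$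 of the error against $\sigma$, tends to $0$ as $\ell\to\infty$. Define $Q_{\mathrm{det}}(\mathcal N)$ and $Q_{\mathrm{rand}}(\mathcal N)$ in the same way from deterministic and random quantum codes of size $L_\ell$ and the infidelity. Then $$C_{\mathrm{det}}(\mathcal N)=\begin{cases}C_{\mathrm{rand}}(\mathcal N)&\text{if }C_{\mathrm{det}}(\mathcal N)>0,\\0&\text{otherwise,}\end{cases}\qquad Q_{\mathrm{det}}(\mathcal N)=\begin{cases}Q_{\mathrm{rand}}(\mathcal N)&\text{if }C_{\mathrm{det}}(\mathcal N)>0,\\0&\text{otherwise.}\end{cases}$$ -/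

import Mathlib

noncomputable section

open scoped Kronecker ComplexOrder

namespace QAVC

/-! A finite-dimensional Hilbert space with a fixed orthonormal basis is represented by the finite
index type of the basis; operators on it are complex matrices. The tensor product of two systems is
indexed by the product type, and the `ℓ`-fold tensor power of `a` by `Fin ℓ → a`. -/

/-- Linear maps `L(a) → L(b)` between operator spaces. -/
abbrev SuperOp (a b : Type*) : Type _ := Matrix a a ℂ →ₗ[ℂ] Matrix b b ℂ

section Maps

variable {r a b : Type*}

/-- The map `id_r ⊗ Φ`: it applies `Φ` to each of the `r × r` blocks. -/
def idTensor (Φ : SuperOp a b) (X : Matrix (r × a) (r × a) ℂ) : Matrix (r × b) (r × b) ℂ :=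
  Matrix.of fun p q => Φ (Matrix.of fun x y => X (p.1, x) (q.1, y)) p.2 q.2

variable [Fintype a]

/-- Completely positive and trace preserving maps. -/
structure IsCPTP [Fintype b] (Φ : SuperOp a b) : Prop where
  completelyPositive : ∀ (k : ℕ) (X : Matrix (Fin k × a) (Fin k × a) ℂ),
    X.PosSemidef → (idTensor Φ X).PosSemidef
  tracePreserving : ∀ X : Matrix a a ℂ, (Φ X).trace = X.trace

/-- The set `S(a)` of states (density operators). -/
def State (a : Type*) [Fintype a] : Type _ :=
  {ρ : Matrix a a ℂ // ρ.PosSemidef ∧ ρ.trace = 1}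

variable [DecidableEq a]

/-- The tensor power `Φ^{⊗ℓ}`, given by linear extension from the matrix units
`⊗ᵢ |xᵢ⟩⟨x'ᵢ| ↦ ⊗ᵢ Φ(|xᵢ⟩⟨x'ᵢ|)`. -/
def tensorPow (Φ : SuperOp a b) (ℓ : ℕ) : SuperOp (Fin ℓ → a) (Fin ℓ → b) where
  toFun X := Matrix.of fun y y' => ∑ x : Fin ℓ → a, ∑ x' : Fin ℓ → a,
    X x x' * ∏ i, Φ (Matrix.single (x i) (x' i) 1) (y i) (y' i)
  map_add' X Y := by
    ext y y'
    simp [add_mul, Finset.sum_add_distrib]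
  map_smul' c X := by
    ext y y'
    simp [Finset.mul_sum, mul_assoc]

/-- `Φ^{⊗ℓ}(X₁ ⊗ ⋯ ⊗ X_ℓ) = Φ(X₁) ⊗ ⋯ ⊗ Φ(X_ℓ)`. -/
theorem tensorPow_product (Φ : SuperOp a b) (ℓ : ℕ) (X : Fin ℓ → Matrix a a ℂ) :
    tensorPow Φ ℓ (Matrix.of fun x x' => ∏ i, X i (x i) (x' i)) =
      Matrix.of fun y y' => ∏ i, Φ (X i) (y i) (y' i) := by
  ext y y'
  have key : ∀ i, Φ (X i) (y i) (y' i) =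
      ∑ p : a, ∑ q : a, X i p q * Φ (Matrix.single p q 1) (y i) (y' i) := by
    intro i
    conv_lhs => rw [Matrix.matrix_eq_sum_single (X i)]
    simp only [map_sum, Matrix.sum_apply]
    refine Finset.sum_congr rfl fun p _ => Finset.sum_congr rfl fun q _ => ?_
    have : Matrix.single p q (X i p q) = X i p q • Matrix.single p q (1 : ℂ) := by simp
    rw [this, map_smul, Matrix.smul_apply, smul_eq_mul]
  simp only [tensorPow, LinearMap.coe_mk, AddHom.coe_mk, Matrix.of_apply, key,
    ← Finset.prod_mul_distrib]
  rw [Finset.prod_univ_sum]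
  simp only [Finset.prod_univ_sum, Fintype.piFinset_univ]

end Maps

section Channel

variable {a j b : Type*} [Fintype a] [DecidableEq a] [Fintype j] [DecidableEq j] [Fintype b]

/-- The block channel `N^{⊗ℓ} : L(A^ℓ ⊗ J^ℓ) → L(B^ℓ)` of `N : L(A ⊗ J) → L(B)`. -/
def blockChannel (N : SuperOp (a × j) b) (ℓ : ℕ) :
    SuperOp ((Fin ℓ → a) × (Fin ℓ → j)) (Fin ℓ → b) :=
  tensorPow N ℓ ∘ₗ (Matrix.reindexLinearEquiv ℂ ℂ
    (Equiv.arrowProdEquivProdArrow (Fin ℓ) (fun _ => a) (fun _ => j)).symm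
    (Equiv.arrowProdEquivProdArrow (Fin ℓ) (fun _ => a) (fun _ => j)).symm).toLinearMap

/-- The channel `N^{⊗ℓ}_σ : L(A^ℓ) → L(B^ℓ)`, `ρ ↦ N^{⊗ℓ}(ρ ⊗ σ)`, for a jammer state `σ` on
`J^ℓ`. -/
def jammed (N : SuperOp (a × j) b) (ℓ : ℕ) (σ : State (Fin ℓ → j)) :
    SuperOp (Fin ℓ → a) (Fin ℓ → b) where
  toFun ρ := blockChannel N ℓ (ρ ⊗ₖ σ.1)
  map_add' ρ ρ' := by rw [Matrix.add_kronecker, map_add]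
  map_smul' c ρ := by rw [Matrix.smul_kronecker, map_smul, RingHom.id_apply]

end Channel

/-- A deterministic classical code of block length `ℓ` with `M` messages. -/
structure ClassicalCode (a b : Type*) [Fintype a] [Fintype b] [DecidableEq b] (ℓ M : ℕ) where
  /-- the signal states -/
  ρ : Fin M → State (Fin ℓ → a)
  /-- the decoding measurement -/
  D : Fin M → Matrix (Fin ℓ → b) (Fin ℓ → b) ℂ
  posSemidef : ∀ m, (D m).PosSemidef
  sum_eq_one : ∑ m, D m = 1

/-- A deterministic quantum code of block length `ℓ` for an `L`-dimensional system. -/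
structure QuantumCode (a b : Type*) [Fintype a] [Fintype b] (ℓ L : ℕ) where
  /-- the encoder -/
  E : SuperOp (Fin L) (Fin ℓ → a)
  /-- the decoder -/
  D : SuperOp (Fin ℓ → b) (Fin L)
  isCPTP_E : IsCPTP E
  isCPTP_D : IsCPTP D

/-- The maximally entangled state `Φ_L = (1/L) ∑_{i,j} |ii⟩⟨jj|`. -/
def maxEntangled (L : ℕ) : Matrix (Fin L × Fin L) (Fin L × Fin L) ℂ :=
  Matrix.of fun p q => if p.1 = p.2 ∧ q.1 = q.2 then (L : ℂ)⁻¹ else 0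

section Errors

variable {a j b : Type*} [Fintype a] [DecidableEq a] [Fintype j] [DecidableEq j]
  [Fintype b]

/-- The average error probability of a classical code against the jammer state `σ`. -/
def ClassicalCode.err [DecidableEq b] {ℓ M : ℕ} (C : ClassicalCode a b ℓ M) (N : SuperOp (a × j) b)
    (σ : State (Fin ℓ → j)) : ℝ :=
  (1 / M : ℝ) * ∑ m, (jammed N ℓ σ (C.ρ m).1 * (1 - C.D m)).trace.re

/-- The infidelity of a quantum code against the jammer state `σ`. -/
def QuantumCode.infid {ℓ L : ℕ} (Q : QuantumCode a b ℓ L) (N : SuperOp (a × j) b)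
    (σ : State (Fin ℓ → j)) : ℝ :=
  1 - (idTensor (Q.D ∘ₗ jammed N ℓ σ ∘ₗ Q.E) (maxEntangled L) * maxEntangled L).trace.re

end Errors

section Random

variable {a j b : Type*} [Fintype a] [DecidableEq a] [Fintype j] [DecidableEq j]
  [Fintype b]

/-- A random classical code for `N`: a random variable with values in `Λ` and distribution `P`, and
deterministic codes indexed by `Λ` whose expected error probability exists for every jammer
state. -/
structure RandomClassicalCode [DecidableEq b] (N : SuperOp (a × j) b) (ℓ M : ℕ) where
  Λ : Type
  mΛ : MeasurableSpace Λ
  P : MeasureTheory.Measure Λ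
  isProb : MeasureTheory.IsProbabilityMeasure P
  code : Λ → ClassicalCode a b ℓ M
  integrable : ∀ σ : State (Fin ℓ → j), MeasureTheory.Integrable (fun t => (code t).err N σ) P

/-- The expected error probability of a random classical code. -/
def RandomClassicalCode.err [DecidableEq b] {N : SuperOp (a × j) b} {ℓ M : ℕ}
    (C : RandomClassicalCode N ℓ M) (σ : State (Fin ℓ → j)) : ℝ :=
  letI := C.mΛ
  ∫ t, (C.code t).err N σ ∂C.P

/-- A random quantum code for `N`. -/
structure RandomQuantumCode (N : SuperOp (a × j) b) (ℓ L : ℕ) where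
  Λ : Type
  mΛ : MeasurableSpace Λ
  P : MeasureTheory.Measure Λ
  isProb : MeasureTheory.IsProbabilityMeasure P
  code : Λ → QuantumCode a b ℓ L
  integrable : ∀ σ : State (Fin ℓ → j), MeasureTheory.Integrable (fun t => (code t).infid N σ) P

/-- The expected infidelity of a random quantum code. -/
def RandomQuantumCode.infid {N : SuperOp (a × j) b} {ℓ L : ℕ} (Q : RandomQuantumCode N ℓ L)
    (σ : State (Fin ℓ → j)) : ℝ :=
  letI := Q.mΛ
  ∫ t, (Q.code t).infid N σ ∂Q.P

end Random

/-- The asymptotic rate `limsup_ℓ (1/ℓ) log₂ (K ℓ)` of code sizes `K`. -/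
def asympRate (K : ℕ → ℕ) : EReal :=
  Filter.limsup (fun ℓ => ((Real.logb 2 (K ℓ) / ℓ : ℝ) : EReal)) Filter.atTop

/-- The worst-case errors `sup_σ err ℓ σ` over the jammer states on `J^ℓ` tend to `0` as
`ℓ → ∞`. -/
def ErrorVanishes {j : Type*} [Fintype j] (err : ∀ ℓ : ℕ, State (Fin ℓ → j) → ℝ) : Prop :=
  Filter.Tendsto (fun ℓ => ⨆ σ : State (Fin ℓ → j), (err ℓ σ : EReal)) Filter.atTop (nhds 0)

section Capacities

variable {a j b : Type*} [Fintype a] [DecidableEq a] [Fintype j] [DecidableEq j]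
  [Fintype b]

/-- The deterministic classical capacity. -/
def Cdet [DecidableEq b] (N : SuperOp (a × j) b) : EReal :=
  sSup {R | ∃ (M : ℕ → ℕ) (C : ∀ ℓ, ClassicalCode a b ℓ (M ℓ)),
    ErrorVanishes (fun ℓ σ => (C ℓ).err N σ) ∧ R = asympRate M}

/-- The random coding classical capacity. -/
def Crand [DecidableEq b] (N : SuperOp (a × j) b) : EReal :=
  sSup {R | ∃ (M : ℕ → ℕ) (C : ∀ ℓ, RandomClassicalCode N ℓ (M ℓ)),
    ErrorVanishes (fun ℓ σ => (C ℓ).err σ) ∧ R = asympRate M}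

/-- The deterministic quantum capacity. -/
def Qdet (N : SuperOp (a × j) b) : EReal :=
  sSup {R | ∃ (L : ℕ → ℕ) (Q : ∀ ℓ, QuantumCode a b ℓ (L ℓ)),
    ErrorVanishes (fun ℓ σ => (Q ℓ).infid N σ) ∧ R = asympRate L}

/-- The random coding quantum capacity. -/
def Qrand (N : SuperOp (a × j) b) : EReal :=
  sSup {R | ∃ (L : ℕ → ℕ) (Q : ∀ ℓ, RandomQuantumCode N ℓ (L ℓ)),
    ErrorVanishes (fun ℓ σ => (Q ℓ).infid σ) ∧ R = asympRate L}

end Capacities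

end QAVC

end

noncomputable section

set_option linter.unusedSectionVars false

open scoped Kronecker ComplexOrder MatrixOrder
open Matrix

namespace QAVC

/-! ### Positive semidefinite matrices and the trace pairing -/

section PositiveMatrices

variable {n : Type*} [Fintype n]

/-! A deterministic code is a random code at a point mass, and `Qdet_le_Cdet` settles the case `Cdet
N = 0`. The content is that a positive `Cdet` allows a random code to be derandomized without loss
of rate, by Ahlswede's elimination of correlation.

Errors are read in the Heisenberg picture on the jammer's side. The error of a code is the
expectation in `σ` of an operator on `J^ℓ` (`eff`, `ClassicalCode.errOp`, `QuantumCode.infidOp`). So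
error at most `ε` against every `σ`, entangled or not, is the operator inequality `X ≤ ε • 1`. On
consecutive blocks these operators tensor (`eff_cat`), and `one_sub_cat_le` is a union bound that
remains valid when the jammer correlates the blocks.

Few codes suffice. At block length `n` the error operators act on a space of dimension `d ^ n`.
Average `K` independent draws of the random error operator and expand the trace of the `2n`-th power
of the centred sum: only words in which no letter occurs exactly once contribute
(`exists_trace_pow_le`). As soon as `K ≥ n ^ 4`, some choice of `K` codes has average error operator
within `O(1/n)` of the bound for the mean (`exists_average_le_of_random`, `moment_condition`).

The index of the chosen code is cheap to transmit. Positivity of `Cdet` yields one test between two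
signals with both errors at most `1/8`. Amplified and repeated, it becomes a code for `k = O(log n)`
bits with length `O(k ^ 3)` and error `O(1/n)` (`HasTest.hasCode_indexBits`). The sender draws the
index locally, sends it ahead, and then uses the code it names, at the cost of the prefix error plus
the average error (`ClassicalCode.exists_concat`, `QuantumCode.exists_concat`). Since `log³ n =
o(n)`, the rate is unchanged (`exists_sequence`). -/

theorem exists_conjTranspose_mul_self {A : Matrix n n ℂ} (hA : A.PosSemidef) :
    ∃ B : Matrix n n ℂ, A = Bᴴ * B := by
  classical
  obtain ⟨B, hB⟩ := (CStarAlgebra.nonneg_iff_eq_star_mul_self (a := A)).1 hA.nonneg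
  exact ⟨B, hB⟩

theorem trace_mul_nonneg {A B : Matrix n n ℂ} (hA : A.PosSemidef) (hB : B.PosSemidef) :
    0 ≤ (A * B).trace := by
  obtain ⟨C, rfl⟩ := exists_conjTranspose_mul_self hB
  rw [← Matrix.mul_assoc, Matrix.trace_mul_comm, ← Matrix.mul_assoc]
  exact (hA.mul_mul_conjTranspose_same C).trace_nonneg

theorem trace_vecMulVec_mul (A : Matrix n n ℂ) (v : n → ℂ) :
    (vecMulVec v (star v) * A).trace = star v ⬝ᵥ A *ᵥ v := by
  rw [Matrix.trace_mul_comm, Matrix.mul_vecMulVec, Matrix.trace_vecMulVec, dotProduct_comm]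

/-- The complex order makes the quadratic form real as well as nonnegative, and over `ℂ` a real
quadratic form already forces the matrix to be Hermitian. -/
theorem posSemidef_of_dotProduct_nonneg {A : Matrix n n ℂ}
    (h : ∀ v : n → ℂ, 0 ≤ star v ⬝ᵥ A *ᵥ v) : A.PosSemidef := by
  classical
  rw [← Matrix.isPositive_toEuclideanLin_iff, LinearMap.isPositive_iff_complex]
  intro x
  have := h x.ofLp
  have e : inner ℂ (Matrix.toEuclideanLin A x) x = star (star x.ofLp ⬝ᵥ A *ᵥ x.ofLp) := by
    rw [EuclideanSpace.inner_eq_star_dotProduct, dotProduct_comm, Matrix.star_dotProduct]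
    rfl
  have h0 : inner ℂ (Matrix.toEuclideanLin A x) x = star x.ofLp ⬝ᵥ A *ᵥ x.ofLp := by
    rw [e]; exact (IsSelfAdjoint.of_nonneg this).star_eq
  rw [h0]
  rw [Complex.le_def] at this
  refine ⟨?_, this.1⟩
  apply Complex.ext
  · simp
  · simpa using this.2

theorem posSemidef_of_trace_mul_nonneg {A : Matrix n n ℂ}
    (h : ∀ X : Matrix n n ℂ, X.PosSemidef → 0 ≤ (X * A).trace) : A.PosSemidef :=
  posSemidef_of_dotProduct_nonneg fun v => by
    rw [← trace_vecMulVec_mul]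
    exact h _ (posSemidef_vecMulVec_self_star v)

theorem posSemidef_single [DecidableEq n] (x : n) : (Matrix.single x x (1 : ℂ)).PosSemidef := by
  convert posSemidef_vecMulVec_self_star (Pi.single x (1 : ℂ)) using 1
  ext y z
  simp only [Matrix.single_apply, vecMulVec_apply, Pi.star_apply, Pi.single_apply]
  by_cases h1 : x = y <;> by_cases h2 : x = z <;> simp [h1, h2, eq_comm]

end PositiveMatrices

/-! ### Completely positive maps: Choi matrix and Kraus operators -/

section CompletelyPositive

variable {a b c : Type*}

/-- Complete positivity. -/
def IsCP (Φ : SuperOp a b) : Prop :=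
  ∀ (k : ℕ) (X : Matrix (Fin k × a) (Fin k × a) ℂ), X.PosSemidef → (idTensor Φ X).PosSemidef

theorem IsCPTP.isCP [Fintype a] [Fintype b] {Φ : SuperOp a b} (h : IsCPTP Φ) : IsCP Φ :=
  h.completelyPositive

theorem IsCP.comp {Ψ : SuperOp b c} {Φ : SuperOp a b} (hΨ : IsCP Ψ) (hΦ : IsCP Φ) :
    IsCP (Ψ ∘ₗ Φ) :=
  fun k X hX => hΨ k _ (hΦ k X hX)

theorem IsCP.sum {κ : Type*} {s : Finset κ} {Φ : κ → SuperOp a b} (h : ∀ k ∈ s, IsCP (Φ k)) :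
    IsCP (∑ k ∈ s, Φ k) := by
  intro r X hX
  have : idTensor (∑ k ∈ s, Φ k) X = ∑ k ∈ s, idTensor (Φ k) X := by
    ext p q
    simp [idTensor, Matrix.sum_apply]
  rw [this]
  exact posSemidef_sum s fun k hk => h k hk r X hX

theorem IsCP.smul {Φ : SuperOp a b} (h : IsCP Φ) {t : ℂ} (ht : 0 ≤ t) : IsCP (t • Φ) := by
  intro r X hX
  have : idTensor (t • Φ) X = t • idTensor Φ X := by
    ext p q
    simp [idTensor]
  rw [this]
  exact (h r X hX).smul ht

theorem IsCP.of_kraus [Fintype a] [Fintype b] {κ : Type*} [Fintype κ] {Φ : SuperOp a b}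
    (K : κ → Matrix b a ℂ) (h : ∀ X, Φ X = ∑ k, K k * X * (K k)ᴴ) : IsCP Φ := by
  classical
  intro r X hX
  have : idTensor Φ X = ∑ k, ((1 : Matrix (Fin r) (Fin r) ℂ) ⊗ₖ K k) * X *
      ((1 : Matrix (Fin r) (Fin r) ℂ) ⊗ₖ K k)ᴴ := by
    ext p q
    simp only [idTensor, h, Matrix.of_apply, Matrix.sum_apply]
    refine Finset.sum_congr rfl fun k _ => ?_
    simp [Matrix.mul_apply, Fintype.sum_prod_type, Matrix.one_apply, ite_mul,
      Finset.sum_ite_irrel, apply_ite]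
  rw [this]
  exact posSemidef_sum _ fun k _ => hX.mul_mul_conjTranspose_same _

theorem superOp_apply_eq_sum [Fintype a] [DecidableEq a] (Φ : SuperOp a b) (X : Matrix a a ℂ)
    (y y' : b) :
    Φ X y y' = ∑ x, ∑ x', X x x' * Φ (Matrix.single x x' 1) y y' := by
  conv_lhs => rw [Matrix.matrix_eq_sum_single X]
  simp only [map_sum, Matrix.sum_apply]
  refine Finset.sum_congr rfl fun p _ => Finset.sum_congr rfl fun q _ => ?_
  have : Matrix.single p q (X p q) = X p q • Matrix.single p q (1 : ℂ) := by simp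
  rw [this, map_smul, Matrix.smul_apply, smul_eq_mul]

/-- The Choi matrix of a completely positive map is positive semidefinite. -/
theorem IsCP.choi_posSemidef [Fintype a] [DecidableEq a] {Φ : SuperOp a b} (h : IsCP Φ) :
    (Matrix.of fun p q : a × b => Φ (Matrix.single p.1 q.1 1) p.2 q.2).PosSemidef := by
  let e := Fintype.equivFin a
  -- The unnormalised maximally entangled vector; the Choi matrix is the image of its projector,
  -- reindexed along `e`.
  let v : Fin (Fintype.card a) × a → ℂ := fun p => if p.1 = e p.2 then 1 else 0
  have h1 := h _ _ (posSemidef_vecMulVec_self_star v)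
  have h2 := h1.submatrix (fun p : a × b => (e p.1, p.2))
  convert h2 using 1
  ext p q
  simp only [Matrix.of_apply, idTensor, Matrix.submatrix_apply]
  refine congrFun (congrFun (congrArg Φ ?_) _) _
  ext x y
  simp only [Matrix.of_apply, vecMulVec_apply, v, Matrix.single_apply, Pi.star_apply,
    EmbeddingLike.apply_eq_iff_eq]
  by_cases h1 : p.1 = x <;> by_cases h2 : q.1 = y <;> simp [h1, h2]

/-- Factor the Choi matrix as `Bᴴ * B`; each row of `B`, conjugated and reshaped into a matrix, is
one Kraus operator. -/
theorem IsCP.exists_kraus [Fintype a] [DecidableEq a] [Fintype b] {Φ : SuperOp a b}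
    (h : IsCP Φ) : ∃ K : a × b → Matrix b a ℂ, ∀ X, Φ X = ∑ k, K k * X * (K k)ᴴ := by
  obtain ⟨B, hB⟩ := exists_conjTranspose_mul_self h.choi_posSemidef
  refine ⟨fun k => Matrix.of fun y x => star (B k (x, y)), fun X => ?_⟩
  ext y y'
  rw [superOp_apply_eq_sum]
  have hB' : ∀ x x', Φ (Matrix.single x x' 1) y y' =
      ∑ k, star (B k (x, y)) * B k (x', y') := by
    intro x x'
    have := congrFun (congrFun hB (x, y)) (x', y')
    simpa [Matrix.mul_apply] using this
  simp only [hB', Matrix.sum_apply, Matrix.mul_apply, Matrix.of_apply, Matrix.conjTranspose_apply,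
    star_star, Finset.sum_mul, Finset.mul_sum]
  rw [Finset.sum_comm]
  conv_rhs => rw [Finset.sum_comm]
  refine Finset.sum_congr rfl fun x' _ => ?_
  rw [Finset.sum_comm]
  refine Finset.sum_congr rfl fun k _ => Finset.sum_congr rfl fun x _ => ?_
  ring

end CompletelyPositive

/-! ### Tensor products over consecutive blocks -/

section Concatenation

variable {c : Type*} {m n : ℕ}

/-- The tensor product `X ⊗ Y` of operators on `c^m` and on `c^n`, as an operator on `c^(m+n)`. -/
def cat : Matrix (Fin m → c) (Fin m → c) ℂ →ₗ[ℂ] Matrix (Fin n → c) (Fin n → c) ℂ →ₗ[ℂ]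
    Matrix (Fin (m + n) → c) (Fin (m + n) → c) ℂ :=
  LinearMap.mk₂ ℂ (fun X Y => Matrix.of fun x x' =>
      X (fun i => x (Fin.castAdd n i)) (fun i => x' (Fin.castAdd n i)) *
        Y (fun i => x (Fin.natAdd m i)) (fun i => x' (Fin.natAdd m i)))
    (fun X X' Y => by ext; simp [add_mul]) (fun t X Y => by ext; simp [mul_assoc])
    (fun X Y Y' => by ext; simp [mul_add]) (fun t X Y => by ext; simp [mul_left_comm])

theorem cat_apply (X : Matrix (Fin m → c) (Fin m → c) ℂ) (Y : Matrix (Fin n → c) (Fin n → c) ℂ)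
    (x x' : Fin (m + n) → c) :
    cat X Y x x' = X (fun i => x (Fin.castAdd n i)) (fun i => x' (Fin.castAdd n i)) *
        Y (fun i => x (Fin.natAdd m i)) (fun i => x' (Fin.natAdd m i)) := rfl

theorem cat_append (X : Matrix (Fin m → c) (Fin m → c) ℂ)
    (Y : Matrix (Fin n → c) (Fin n → c) ℂ) (x₁ x₁' : Fin m → c) (x₂ x₂' : Fin n → c) :
    cat X Y (Fin.append x₁ x₂) (Fin.append x₁' x₂') = X x₁ x₁' * Y x₂ x₂' := by
  simp [cat_apply]

theorem sum_fin_add [Fintype c] {E : Type*} [AddCommMonoid E] (F : (Fin (m + n) → c) → E) :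
    ∑ x, F x = ∑ x₁ : Fin m → c, ∑ x₂ : Fin n → c, F (Fin.append x₁ x₂) := by
  rw [← (Fin.appendEquiv m n).sum_comp, Fintype.sum_prod_type]
  rfl

theorem matrix_ext_append {E : Type*} {X Y : Matrix (Fin (m + n) → c) (Fin (m + n) → c) E}
    (h : ∀ (x₁ x₁' : Fin m → c) (x₂ x₂' : Fin n → c),
      X (Fin.append x₁ x₂) (Fin.append x₁' x₂') = Y (Fin.append x₁ x₂) (Fin.append x₁' x₂')) :
    X = Y := by
  ext x x'
  have := h (fun i => x (Fin.castAdd n i)) (fun i => x' (Fin.castAdd n i))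
    (fun i => x (Fin.natAdd m i)) (fun i => x' (Fin.natAdd m i))
  simpa [Fin.append_castAdd_natAdd] using this

theorem cat_posSemidef [Finite c] {X : Matrix (Fin m → c) (Fin m → c) ℂ}
    {Y : Matrix (Fin n → c) (Fin n → c) ℂ} (hX : X.PosSemidef) (hY : Y.PosSemidef) :
    (cat X Y).PosSemidef :=
  (hX.kronecker hY).submatrix
    fun x : Fin (m + n) → c => (fun i => x (Fin.castAdd n i), fun i => x (Fin.natAdd m i))

theorem trace_cat [Fintype c] (X : Matrix (Fin m → c) (Fin m → c) ℂ)
    (Y : Matrix (Fin n → c) (Fin n → c) ℂ) : (cat X Y).trace = X.trace * Y.trace := by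
  simp only [Matrix.trace, Matrix.diag_apply, sum_fin_add, cat_append, Finset.sum_mul_sum]

theorem cat_mul_cat [Fintype c] (X X' : Matrix (Fin m → c) (Fin m → c) ℂ)
    (Y Y' : Matrix (Fin n → c) (Fin n → c) ℂ) :
    cat X Y * cat X' Y' = cat (X * X') (Y * Y') := by
  refine matrix_ext_append fun x₁ x₁' x₂ x₂' => ?_
  simp only [Matrix.mul_apply, sum_fin_add, cat_append, Finset.sum_mul_sum]
  refine Finset.sum_congr rfl fun _ _ => Finset.sum_congr rfl fun _ _ => ?_
  ring

theorem append_inj_iff {x₁ x₁' : Fin m → c} {x₂ x₂' : Fin n → c} :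
    Fin.append x₁ x₂ = Fin.append x₁' x₂' ↔ x₁ = x₁' ∧ x₂ = x₂' := by
  have := (Fin.appendEquiv (α := c) m n).injective.eq_iff (a := (x₁, x₂)) (b := (x₁', x₂'))
  simpa [Fin.appendEquiv] using this

@[simp]
theorem cat_one_one [DecidableEq c] :
    cat (1 : Matrix (Fin m → c) (Fin m → c) ℂ) (1 : Matrix (Fin n → c) (Fin n → c) ℂ) = 1 := by
  refine matrix_ext_append fun y₁ y₁' y₂ y₂' => ?_
  simp only [cat_append, Matrix.one_apply, append_inj_iff, mul_ite, mul_one, mul_zero]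
  split_ifs <;> simp_all

end Concatenation

/-! ### Tensor powers of channels -/

section TensorPower

variable {a b : Type*} [Fintype a] [DecidableEq a]

theorem tensorPow_kraus {κ : Type*} [Fintype κ] {Φ : SuperOp a b} {K : κ → Matrix b a ℂ}
    (h : ∀ X, Φ X = ∑ k, K k * X * (K k)ᴴ) (ℓ : ℕ) (X : Matrix (Fin ℓ → a) (Fin ℓ → a) ℂ) :
    tensorPow Φ ℓ X = ∑ k : Fin ℓ → κ,
      (Matrix.of fun (y : Fin ℓ → b) (x : Fin ℓ → a) => ∏ i, K (k i) (y i) (x i)) * X *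
        (Matrix.of fun (y : Fin ℓ → b) (x : Fin ℓ → a) => ∏ i, K (k i) (y i) (x i))ᴴ := by
  classical
  ext y y'
  have h1 : ∀ x x' y y', Φ (Matrix.single x x' 1) y y' = ∑ k, K k y x * star (K k y' x') := by
    intro x x' y y'
    simp [h, Matrix.sum_apply, Matrix.mul_apply, Matrix.single_apply, ite_and]
  simp only [tensorPow, LinearMap.coe_mk, AddHom.coe_mk, Matrix.of_apply, h1,
    Finset.prod_univ_sum, Fintype.piFinset_univ, Matrix.sum_apply, Matrix.mul_apply,
    Matrix.conjTranspose_apply, star_prod, Finset.sum_mul, Finset.mul_sum,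
    Finset.prod_mul_distrib]
  rw [Finset.sum_comm]
  conv_rhs => rw [Finset.sum_comm]
  refine Finset.sum_congr rfl fun x' _ => ?_
  rw [Finset.sum_comm]
  refine Finset.sum_congr rfl fun k _ => Finset.sum_congr rfl fun x _ => ?_
  ring

theorem trace_tensorPow [Fintype b] {Φ : SuperOp a b} (h : ∀ X, (Φ X).trace = X.trace) (ℓ : ℕ)
    (X : Matrix (Fin ℓ → a) (Fin ℓ → a) ℂ) : (tensorPow Φ ℓ X).trace = X.trace := by
  have h1 : ∀ x x' : Fin ℓ → a, ∑ y : Fin ℓ → b,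
      ∏ i, Φ (Matrix.single (x i) (x' i) 1) (y i) (y i) = if x = x' then 1 else 0 := by
    intro x x'
    rw [← Fintype.piFinset_univ, ← Finset.prod_univ_sum (fun _ => Finset.univ)
      (fun i y => Φ (Matrix.single (x i) (x' i) 1) y y)]
    have : ∀ i, ∑ y, Φ (Matrix.single (x i) (x' i) 1) y y = if x i = x' i then 1 else 0 := by
      intro i
      have := h (Matrix.single (x i) (x' i) 1)
      simp only [Matrix.trace, Matrix.diag_apply] at this
      rw [this]
      simp [Matrix.single_apply, ite_and, eq_comm]
    simp only [this]
    rw [Finset.prod_ite_zero]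
    simp [funext_iff]
  simp only [Matrix.trace, Matrix.diag_apply, tensorPow, LinearMap.coe_mk, AddHom.coe_mk,
    Matrix.of_apply]
  rw [Finset.sum_comm]
  refine Finset.sum_congr rfl fun x _ => ?_
  rw [Finset.sum_comm]
  simp [← Finset.mul_sum, h1]

end TensorPower

/-! ### The block channel in the Heisenberg picture on the jammer system -/

section Effect

variable {a j b : Type*} [Fintype a] [DecidableEq a] [Fintype j] [DecidableEq j]

theorem blockChannel_kraus {κ : Type*} [Fintype κ] {N : SuperOp (a × j) b}
    {K : κ → Matrix b (a × j) ℂ} (h : ∀ X, N X = ∑ k, K k * X * (K k)ᴴ) (ℓ : ℕ) :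
    ∃ V : (Fin ℓ → κ) → Matrix (Fin ℓ → b) ((Fin ℓ → a) × (Fin ℓ → j)) ℂ,
      ∀ X, blockChannel N ℓ X = ∑ k, V k * X * (V k)ᴴ := by
  refine ⟨fun k => Matrix.of fun y x => ∏ i, K (k i) (y i) (x.1 i, x.2 i), fun X => ?_⟩
  simp only [blockChannel, LinearMap.comp_apply, tensorPow_kraus h]
  refine Finset.sum_congr rfl fun k _ => ?_
  ext y y'
  simp only [Matrix.mul_apply, Matrix.conjTranspose_apply, Matrix.of_apply]
  refine Fintype.sum_equiv (Equiv.arrowProdEquivProdArrow (Fin ℓ) (fun _ => a) (fun _ => j))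
    _ _ fun x => ?_
  congr 1
  refine Fintype.sum_equiv (Equiv.arrowProdEquivProdArrow (Fin ℓ) (fun _ => a) (fun _ => j))
    _ _ fun x' => ?_
  rfl

theorem trace_blockChannel [Fintype b] {N : SuperOp (a × j) b} (h : ∀ X, (N X).trace = X.trace)
    (ℓ : ℕ) (X : Matrix ((Fin ℓ → a) × (Fin ℓ → j)) ((Fin ℓ → a) × (Fin ℓ → j)) ℂ) :
    (blockChannel N ℓ X).trace = X.trace := by
  simp only [blockChannel, LinearMap.comp_apply, trace_tensorPow h]
  simp only [Matrix.trace, Matrix.diag_apply]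
  exact Fintype.sum_equiv (Equiv.arrowProdEquivProdArrow (Fin ℓ) (fun _ => a) (fun _ => j))
    _ _ fun x => rfl

theorem blockChannel_kronecker_single (N : SuperOp (a × j) b) (ℓ : ℕ)
    (ρ : Matrix (Fin ℓ → a) (Fin ℓ → a) ℂ) (s s' : Fin ℓ → j) (y y' : Fin ℓ → b) :
    blockChannel N ℓ (ρ ⊗ₖ Matrix.single s s' 1) y y' = ∑ x, ∑ x', ρ x x' *
      ∏ i, N (Matrix.single (x i, s i) (x' i, s' i) 1) (y i) (y' i) := by
  have h : ∀ F : (Fin ℓ → a × j) → ℂ, ∑ z, F z =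
      ∑ x : Fin ℓ → a, ∑ t : Fin ℓ → j, F (fun i => (x i, t i)) := by
    intro F
    rw [← Fintype.sum_prod_type']
    exact Fintype.sum_equiv (Equiv.arrowProdEquivProdArrow (Fin ℓ) (fun _ => a) (fun _ => j))
      _ _ fun x => rfl
  have h2 : ∀ x x' : Fin ℓ → a × j, (Matrix.reindexLinearEquiv ℂ ℂ
      (Equiv.arrowProdEquivProdArrow (Fin ℓ) (fun _ => a) (fun _ => j)).symm
      (Equiv.arrowProdEquivProdArrow (Fin ℓ) (fun _ => a) (fun _ => j)).symm).toLinearMap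
      (ρ ⊗ₖ Matrix.single s s' (1 : ℂ)) x x' = ρ (fun i => (x i).1) (fun i => (x' i).1) *
        if s = (fun i => (x i).2) ∧ s' = (fun i => (x' i).2) then 1 else 0 := by
    intro x x'
    rfl
  simp only [blockChannel, LinearMap.comp_apply, tensorPow, LinearMap.coe_mk, AddHom.coe_mk,
    Matrix.of_apply, h2, h]
  simp [ite_and, Finset.sum_ite_irrel]

variable [Fintype b]

/-- The operator `eff N ℓ ρ D` on `J^ℓ` with `tr (N^{⊗ℓ}(ρ ⊗ σ) D) = tr (σ · eff N ℓ ρ D)` for all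
`σ`. -/
def eff (N : SuperOp (a × j) b) (ℓ : ℕ) : Matrix (Fin ℓ → a) (Fin ℓ → a) ℂ →ₗ[ℂ]
    Matrix (Fin ℓ → b) (Fin ℓ → b) ℂ →ₗ[ℂ] Matrix (Fin ℓ → j) (Fin ℓ → j) ℂ :=
  LinearMap.mk₂ ℂ (fun ρ D => Matrix.of fun s' s =>
      (blockChannel N ℓ (ρ ⊗ₖ Matrix.single s s' 1) * D).trace)
    (fun X X' Y => by ext; simp [Matrix.add_kronecker, add_mul])
    (fun t X Y => by ext; simp [Matrix.smul_kronecker])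
    (fun X Y Y' => by ext; simp [mul_add])
    (fun t X Y => by ext; simp)

theorem eff_apply (N : SuperOp (a × j) b) (ℓ : ℕ) (ρ : Matrix (Fin ℓ → a) (Fin ℓ → a) ℂ)
    (D : Matrix (Fin ℓ → b) (Fin ℓ → b) ℂ) (s' s : Fin ℓ → j) :
    eff N ℓ ρ D s' s = (blockChannel N ℓ (ρ ⊗ₖ Matrix.single s s' 1) * D).trace := rfl

theorem trace_mul_eff (N : SuperOp (a × j) b) (ℓ : ℕ) (ρ : Matrix (Fin ℓ → a) (Fin ℓ → a) ℂ)
    (D : Matrix (Fin ℓ → b) (Fin ℓ → b) ℂ) (σ : Matrix (Fin ℓ → j) (Fin ℓ → j) ℂ) :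
    (σ * eff N ℓ ρ D).trace = (blockChannel N ℓ (ρ ⊗ₖ σ) * D).trace := by
  let f : Matrix (Fin ℓ → j) (Fin ℓ → j) ℂ →ₗ[ℂ] ℂ :=
    { toFun := fun σ => (blockChannel N ℓ (ρ ⊗ₖ σ) * D).trace
      map_add' := fun X Y => by simp [Matrix.kronecker_add, add_mul]
      map_smul' := fun t X => by simp [Matrix.kronecker_smul] }
  change _ = f σ
  conv_rhs => rw [Matrix.matrix_eq_sum_single σ]
  have : ∀ s s', f (Matrix.single s s' (σ s s')) = σ s s' * eff N ℓ ρ D s' s := by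
    intro s s'
    have : Matrix.single s s' (σ s s') = σ s s' • Matrix.single s s' (1 : ℂ) := by simp
    rw [this, map_smul]
    rfl
  simp only [map_sum, this]
  simp [Matrix.trace, Matrix.mul_apply]

theorem jammed_trace_mul (N : SuperOp (a × j) b) (ℓ : ℕ) (σ : State (Fin ℓ → j))
    (ρ : Matrix (Fin ℓ → a) (Fin ℓ → a) ℂ) (D : Matrix (Fin ℓ → b) (Fin ℓ → b) ℂ) :
    (jammed N ℓ σ ρ * D).trace = (σ.1 * eff N ℓ ρ D).trace :=
  (trace_mul_eff N ℓ ρ D σ.1).symm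

theorem blockChannel_posSemidef {N : SuperOp (a × j) b} (hN : IsCP N) (ℓ : ℕ)
    {X : Matrix ((Fin ℓ → a) × (Fin ℓ → j)) ((Fin ℓ → a) × (Fin ℓ → j)) ℂ} (hX : X.PosSemidef) :
    (blockChannel N ℓ X).PosSemidef := by
  obtain ⟨K, hK⟩ := hN.exists_kraus
  obtain ⟨V, hV⟩ := blockChannel_kraus hK ℓ
  rw [hV]
  exact posSemidef_sum _ fun k _ => hX.mul_mul_conjTranspose_same _

theorem eff_posSemidef {N : SuperOp (a × j) b} (hN : IsCP N) {ℓ : ℕ}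
    {ρ : Matrix (Fin ℓ → a) (Fin ℓ → a) ℂ} {D : Matrix (Fin ℓ → b) (Fin ℓ → b) ℂ}
    (hρ : ρ.PosSemidef) (hD : D.PosSemidef) : (eff N ℓ ρ D).PosSemidef := by
  refine posSemidef_of_trace_mul_nonneg fun X hX => ?_
  rw [trace_mul_eff]
  exact trace_mul_nonneg (blockChannel_posSemidef hN ℓ (hρ.kronecker hX)) hD

theorem eff_one [DecidableEq b] {N : SuperOp (a × j) b} (hN : IsCPTP N) {ℓ : ℕ}
    (ρ : Matrix (Fin ℓ → a) (Fin ℓ → a) ℂ) : eff N ℓ ρ 1 = ρ.trace • 1 := by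
  ext s' s
  rw [eff_apply, Matrix.mul_one, trace_blockChannel hN.tracePreserving, Matrix.trace_kronecker]
  simp [Matrix.trace, Matrix.single_apply, Matrix.one_apply, ite_and]

/-- The block channel factorizes over matrix units of the jammer system. This is an identity of
operators, so it can be tested against states entangled across the two blocks. -/
theorem eff_cat (N : SuperOp (a × j) b) {m n : ℕ} (ρ₁ : Matrix (Fin m → a) (Fin m → a) ℂ)
    (ρ₂ : Matrix (Fin n → a) (Fin n → a) ℂ) (D₁ : Matrix (Fin m → b) (Fin m → b) ℂ)
    (D₂ : Matrix (Fin n → b) (Fin n → b) ℂ) :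
    eff N (m + n) (cat ρ₁ ρ₂) (cat D₁ D₂) = cat (eff N m ρ₁ D₁) (eff N n ρ₂ D₂) := by
  refine matrix_ext_append fun s₁' s₁ s₂' s₂ => ?_
  rw [cat_append, eff_apply, eff_apply, eff_apply]
  have : blockChannel N (m + n)
      (cat ρ₁ ρ₂ ⊗ₖ Matrix.single (Fin.append s₁ s₂) (Fin.append s₁' s₂') 1) =
      cat (blockChannel N m (ρ₁ ⊗ₖ Matrix.single s₁ s₁' 1))
        (blockChannel N n (ρ₂ ⊗ₖ Matrix.single s₂ s₂' 1)) := by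
    refine matrix_ext_append fun y₁ y₁' y₂ y₂' => ?_
    simp only [cat_append, blockChannel_kronecker_single, sum_fin_add, Finset.sum_mul_sum,
      Fin.prod_univ_add, Fin.append_left, Fin.append_right]
    refine Finset.sum_congr rfl fun _ _ => Finset.sum_congr rfl fun _ _ =>
      Finset.sum_congr rfl fun _ _ => Finset.sum_congr rfl fun _ _ => ?_
    ring
  rw [this, cat_mul_cat, trace_cat]

end Effect

/-! ### Operator inequalities and worst-case jammer states -/

section Order

theorem cat_nonneg {c : Type*} [Finite c] {m n : ℕ} {X : Matrix (Fin m → c) (Fin m → c) ℂ}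
    {Y : Matrix (Fin n → c) (Fin n → c) ℂ} (hX : 0 ≤ X) (hY : 0 ≤ Y) : 0 ≤ cat X Y :=
  (cat_posSemidef hX.posSemidef hY.posSemidef).nonneg

theorem cat_mono {c : Type*} [Finite c] {m n : ℕ} {X X' : Matrix (Fin m → c) (Fin m → c) ℂ}
    {Y Y' : Matrix (Fin n → c) (Fin n → c) ℂ} (hX : X ≤ X') (hY : Y ≤ Y') (hX' : 0 ≤ X')
    (hY0 : 0 ≤ Y) : cat X Y ≤ cat X' Y' := by
  have h1 := cat_nonneg (sub_nonneg.2 hX) hY0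
  have h2 := cat_nonneg hX' (sub_nonneg.2 hY)
  rw [map_sub, LinearMap.sub_apply, sub_nonneg] at h1
  rw [map_sub, sub_nonneg] at h2
  exact h1.trans h2

/-- A union bound for operators: the difference of the two sides is `(1 - X) ⊗ (1 - Y)`, which is
positive. -/
theorem one_sub_cat_le {c : Type*} [Finite c] [DecidableEq c] {m n : ℕ}
    {X : Matrix (Fin m → c) (Fin m → c) ℂ} {Y : Matrix (Fin n → c) (Fin n → c) ℂ} (hX : X ≤ 1)
    (hY : Y ≤ 1) : 1 - cat X Y ≤ cat (1 - X) 1 + cat 1 (1 - Y) := by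
  have h1 := cat_nonneg (sub_nonneg.2 hX) (sub_nonneg.2 hY)
  rw [← sub_nonneg]
  convert h1 using 1
  simp only [map_sub, LinearMap.sub_apply, cat_one_one]
  abel

theorem trace_mul_mono {n : Type*} [Fintype n] {σ X Y : Matrix n n ℂ} (hσ : σ.PosSemidef)
    (h : X ≤ Y) : (σ * X).trace.re ≤ (σ * Y).trace.re := by
  have := trace_mul_nonneg hσ (sub_nonneg.2 h).posSemidef
  rw [mul_sub, Matrix.trace_sub] at this
  have := (Complex.le_def.1 this).1
  simpa using this

theorem trace_state_mul_le {n : Type*} [Fintype n] [DecidableEq n] {X : Matrix n n ℂ} {t : ℝ}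
    (h : X ≤ t • (1 : Matrix n n ℂ)) (σ : State n) : (σ.1 * X).trace.re ≤ t := by
  have := trace_mul_mono σ.2.1 h
  rw [Matrix.mul_smul, Matrix.mul_one, Matrix.trace_smul, σ.2.2] at this
  simpa using this

theorem exists_state_dotProduct_mulVec {n : Type*} [Fintype n] {v : n → ℂ} (hv : v ≠ 0) :
    ∃ σ : State n, ∀ X : Matrix n n ℂ,
      star v ⬝ᵥ X *ᵥ v = (star v ⬝ᵥ v).re * (σ.1 * X).trace := by
  have h0 : 0 ≤ star v ⬝ᵥ v := dotProduct_star_self_nonneg v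
  have h1 : star v ⬝ᵥ v ≠ 0 := by simpa using hv
  have h2 : (((star v ⬝ᵥ v).re : ℝ) : ℂ) = star v ⬝ᵥ v :=
    Complex.ext rfl (by simpa using (Complex.le_def.1 h0).2)
  refine ⟨⟨(star v ⬝ᵥ v)⁻¹ • vecMulVec v (star v), ?_, ?_⟩, fun X => ?_⟩
  · exact (posSemidef_vecMulVec_self_star v).smul (inv_nonneg.2 h0)
  · rw [Matrix.trace_smul, Matrix.trace_vecMulVec, dotProduct_comm v, smul_eq_mul,
      inv_mul_cancel₀ h1]
  · rw [h2, Matrix.smul_mul, Matrix.trace_smul, trace_vecMulVec_mul, smul_eq_mul,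
      mul_inv_cancel_left₀ h1]

/-- Pure states see every value of the normalised quadratic form. With `trace_state_mul_le` this
identifies a worst-case bound over jammer states with an operator inequality. -/
theorem le_smul_one_of_forall_state {n : Type*} [Fintype n] [DecidableEq n] {X : Matrix n n ℂ}
    (hX : X.PosSemidef) {t : ℝ} (h : ∀ σ : State n, (σ.1 * X).trace.re ≤ t) :
    X ≤ t • (1 : Matrix n n ℂ) := by
  rw [Matrix.le_iff]
  refine posSemidef_of_dotProduct_nonneg fun v => ?_
  by_cases hv : v = 0
  · simp [hv]
  obtain ⟨σ, hσ⟩ := exists_state_dotProduct_mulVec hv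
  have h0 : 0 ≤ star v ⬝ᵥ v := dotProduct_star_self_nonneg v
  have h3 := trace_mul_nonneg σ.2.1 hX
  rw [Matrix.sub_mulVec, dotProduct_sub, hσ X, Matrix.smul_mulVec, Matrix.one_mulVec,
    dotProduct_smul]
  rw [Complex.le_def] at h0 h3 ⊢
  simp only [Complex.zero_re, Complex.zero_im] at h0 h3
  simp only [Complex.zero_re, Complex.sub_re, Complex.smul_re, smul_eq_mul, Complex.mul_re,
    Complex.ofReal_re, Complex.ofReal_im, zero_mul, sub_zero, Complex.zero_im, Complex.sub_im,
    Complex.smul_im, Complex.mul_im, add_zero, ← h0.2, ← h3.2, mul_zero]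
  exact ⟨by nlinarith [h σ, h0.1], trivial⟩

end Order

/-! ### Products and mixtures of states -/

section States

variable {c : Type*} [Fintype c]

/-- The product of two states. -/
def State.cat {m n : ℕ} (ρ : State (Fin m → c)) (τ : State (Fin n → c)) :
    State (Fin (m + n) → c) :=
  ⟨QAVC.cat ρ.1 τ.1, cat_posSemidef ρ.2.1 τ.2.1, by rw [trace_cat, ρ.2.2, τ.2.2, mul_one]⟩

/-- The uniform mixture of a nonempty family of states. -/
def State.avg {κ : Type*} (s : Finset κ) (hs : s.Nonempty) (ρ : κ → State c) : State c :=
  ⟨(s.card : ℝ)⁻¹ • ∑ k ∈ s, (ρ k).1,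
    (smul_nonneg (by positivity)
      (Finset.sum_nonneg fun k _ => (ρ k).2.1.nonneg)).posSemidef, by
    have : (s.card : ℂ) ≠ 0 := by exact_mod_cast hs.card_pos.ne'
    rw [Matrix.trace_smul, Matrix.trace_sum, Finset.sum_congr rfl fun k _ => (ρ k).2.2]
    simp [this]⟩

instance [Nonempty c] : Nonempty (State c) := by
  classical
  obtain ⟨x⟩ := ‹Nonempty c›
  exact ⟨⟨Matrix.single x x 1, posSemidef_single x, by simp⟩⟩

end States

/-! ### Binary tests, their amplification, and codes built from them -/

section Tests

variable {a j b : Type*} [Fintype a] [DecidableEq a] [Fintype j] [DecidableEq j] [Fintype b]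
  [DecidableEq b] {N : SuperOp (a × j) b} {ℓ : ℕ}

theorem eff_nonneg (hN : IsCPTP N) (ρ : State (Fin ℓ → a))
    {D : Matrix (Fin ℓ → b) (Fin ℓ → b) ℂ} (hD : 0 ≤ D) : 0 ≤ eff N ℓ ρ.1 D :=
  (eff_posSemidef hN.isCP ρ.2.1 hD.posSemidef).nonneg

theorem eff_mono (hN : IsCPTP N) (ρ : State (Fin ℓ → a))
    {D D' : Matrix (Fin ℓ → b) (Fin ℓ → b) ℂ} (hD : D ≤ D') :
    eff N ℓ ρ.1 D ≤ eff N ℓ ρ.1 D' := by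
  rw [← sub_nonneg, ← map_sub]
  exact eff_nonneg hN ρ (sub_nonneg.2 hD)

theorem eff_state_one (hN : IsCPTP N) (ρ : State (Fin ℓ → a)) : eff N ℓ ρ.1 1 = 1 := by
  rw [eff_one hN, ρ.2.2, one_smul]

theorem eff_le_one (hN : IsCPTP N) (ρ : State (Fin ℓ → a))
    {D : Matrix (Fin ℓ → b) (Fin ℓ → b) ℂ} (hD : D ≤ 1) : eff N ℓ ρ.1 D ≤ 1 :=
  (eff_mono hN ρ hD).trans_eq (eff_state_one hN ρ)

theorem eff_cat_one_sub_le (hN : IsCPTP N) {m n : ℕ} (ρ : State (Fin m → a))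
    (τ : State (Fin n → a)) {D : Matrix (Fin m → b) (Fin m → b) ℂ}
    {D' : Matrix (Fin n → b) (Fin n → b) ℂ} (hD : D ≤ 1) (hD' : D' ≤ 1) :
    eff N (m + n) (cat ρ.1 τ.1) (1 - cat D D') ≤
      cat (eff N m ρ.1 (1 - D)) 1 + cat 1 (eff N n τ.1 (1 - D')) := by
  have h₁ : eff N m ρ.1 (1 - D) = 1 - eff N m ρ.1 D := by rw [map_sub, eff_state_one hN]
  have h₂ : eff N n τ.1 (1 - D') = 1 - eff N n τ.1 D' := by rw [map_sub, eff_state_one hN]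
  have h₃ : eff N (m + n) (cat ρ.1 τ.1) 1 = 1 := eff_state_one hN (ρ.cat τ)
  rw [map_sub, eff_cat, h₁, h₂, h₃]
  exact one_sub_cat_le (eff_le_one hN ρ hD) (eff_le_one hN τ hD')

theorem cat_smul_one_one {c : Type*} [DecidableEq c] {m n : ℕ} (t : ℝ) :
    cat (t • (1 : Matrix (Fin m → c) (Fin m → c) ℂ)) (1 : Matrix (Fin n → c) (Fin n → c) ℂ) =
      t • (1 : Matrix (Fin (m + n) → c) (Fin (m + n) → c) ℂ) := by
  rw [← Complex.coe_smul, map_smul, LinearMap.smul_apply, cat_one_one, Complex.coe_smul]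

theorem cat_one_smul_one {c : Type*} [DecidableEq c] {m n : ℕ} (t : ℝ) :
    cat (1 : Matrix (Fin m → c) (Fin m → c) ℂ) (t • (1 : Matrix (Fin n → c) (Fin n → c) ℂ)) =
      t • (1 : Matrix (Fin (m + n) → c) (Fin (m + n) → c) ℂ) := by
  rw [← Complex.coe_smul, map_smul, cat_one_one, Complex.coe_smul]

/-- There is a pair of signal states of block length `ℓ` and a test which, against every jammer
state, confuses the first with the second with probability at most `e₀` and the second with the
first with probability at most `e₁`. -/
def HasTest (N : SuperOp (a × j) b) (ℓ : ℕ) (e₀ e₁ : ℝ) : Prop :=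
  ∃ (ρ₀ ρ₁ : State (Fin ℓ → a)) (D : Matrix (Fin ℓ → b) (Fin ℓ → b) ℂ), 0 ≤ D ∧ D ≤ 1 ∧
    eff N ℓ ρ₀.1 D ≤ e₀ • (1 : Matrix (Fin ℓ → j) (Fin ℓ → j) ℂ) ∧
    eff N ℓ ρ₁.1 (1 - D) ≤ e₁ • (1 : Matrix (Fin ℓ → j) (Fin ℓ → j) ℂ)

theorem HasTest.swap {e₀ e₁ : ℝ} (h : HasTest N ℓ e₀ e₁) : HasTest N ℓ e₁ e₀ := by
  obtain ⟨ρ₀, ρ₁, D, h0, h1, h2, h3⟩ := h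
  exact ⟨ρ₁, ρ₀, 1 - D, sub_nonneg.2 h1, sub_le_self _ h0, h3, by rwa [sub_sub_cancel]⟩

theorem HasTest.mono {e₀ e₁ e₀' e₁' : ℝ} (h : HasTest N ℓ e₀ e₁) (h₀ : e₀ ≤ e₀')
    (h₁ : e₁ ≤ e₁') : HasTest N ℓ e₀' e₁' := by
  obtain ⟨ρ₀, ρ₁, D, h0, h1, h2, h3⟩ := h
  exact ⟨ρ₀, ρ₁, D, h0, h1, h2.trans (smul_le_smul_of_nonneg_right h₀ PosSemidef.one.nonneg),
    h3.trans (smul_le_smul_of_nonneg_right h₁ PosSemidef.one.nonneg)⟩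

/-- Repeat the signal and accept only when both blocks accept. False acceptance then has a product
effect, so its bound squares; false rejection is covered by the union bound, so its bound doubles.
-/
theorem HasTest.double (hN : IsCPTP N) {e₀ e₁ : ℝ} (he : 0 ≤ e₀) (h : HasTest N ℓ e₀ e₁) :
    HasTest N (ℓ + ℓ) (e₀ ^ 2) (2 * e₁) := by
  obtain ⟨ρ₀, ρ₁, D, h0, h1, h2, h3⟩ := h
  have hone : ∀ m, (0 : Matrix (Fin m → j) (Fin m → j) ℂ) ≤ 1 := fun m => PosSemidef.one.nonneg
  refine ⟨ρ₀.cat ρ₀, ρ₁.cat ρ₁, cat D D, cat_nonneg h0 h0, ?_, ?_, ?_⟩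
  · rw [← cat_one_one]
    exact cat_mono h1 h1 PosSemidef.one.nonneg h0
  · change eff N (ℓ + ℓ) (cat ρ₀.1 ρ₀.1) _ ≤ _
    rw [eff_cat]
    refine (cat_mono h2 h2 (smul_nonneg he (hone _)) (eff_nonneg hN ρ₀ h0)).trans_eq ?_
    rw [← Complex.coe_smul, map_smul, Complex.coe_smul, Complex.coe_smul, cat_smul_one_one,
      smul_smul, sq]
  · refine (eff_cat_one_sub_le hN ρ₁ ρ₁ h1 h1).trans ?_
    have h4 := eff_nonneg hN ρ₁ (sub_nonneg.2 h1)
    rw [two_mul, add_smul]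
    refine add_le_add ?_ ?_
    · rw [← cat_smul_one_one]
      exact cat_mono h3 le_rfl (h4.trans h3) (hone _)
    · rw [← cat_one_smul_one]
      exact cat_mono le_rfl h3 (hone _) h4

/-- Doubling once for each kind of error takes `(e, e)` through `(e², 2e)` to `(4e², 2e²)` up to
order. Thus `4e` squares while the length is multiplied by four. -/
theorem HasTest.amplify (hN : IsCPTP N) {e : ℝ} (he : 0 ≤ e) (h : HasTest N ℓ e e) (r : ℕ) :
    HasTest N (4 ^ r * ℓ) ((4 * e) ^ 2 ^ r / 4) ((4 * e) ^ 2 ^ r / 4) := by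
  induction r with
  | zero => simpa using h
  | succ r ih =>
    set x := (4 * e) ^ 2 ^ r with hx
    have hx0 : 0 ≤ x := by positivity
    have h1 := ((ih.double hN (by positivity)).swap.double hN (by positivity))
    have e1 : 4 ^ (r + 1) * ℓ = (4 ^ r * ℓ + 4 ^ r * ℓ) + (4 ^ r * ℓ + 4 ^ r * ℓ) := by ring
    have e2 : (4 * e) ^ 2 ^ (r + 1) = x ^ 2 := by rw [hx, ← pow_mul, pow_succ]
    rw [e1, e2]
    exact h1.mono (by nlinarith) (by nlinarith)

/-- There is a classical code with `K` messages of block length `ℓ` whose maximal error probability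
is at most `e`, against every jammer state. -/
def HasCode (N : SuperOp (a × j) b) (ℓ K : ℕ) (e : ℝ) : Prop :=
  ∃ C : ClassicalCode a b ℓ K, ∀ k,
    eff N ℓ (C.ρ k).1 (1 - C.D k) ≤ e • (1 : Matrix (Fin ℓ → j) (Fin ℓ → j) ℂ)

theorem ClassicalCode.D_nonneg {M : ℕ} (C : ClassicalCode a b ℓ M) (m : Fin M) : 0 ≤ C.D m :=
  (C.posSemidef m).nonneg

theorem ClassicalCode.D_le_one {M : ℕ} (C : ClassicalCode a b ℓ M) (m : Fin M) : C.D m ≤ 1 := by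
  rw [← C.sum_eq_one]
  exact Finset.single_le_sum (fun m _ => C.D_nonneg m) (Finset.mem_univ m)

theorem HasTest.hasCode {e : ℝ} (h : HasTest N ℓ e e) : HasCode N ℓ 2 e := by
  obtain ⟨ρ₀, ρ₁, D, h0, h1, h2, h3⟩ := h
  refine ⟨⟨![ρ₀, ρ₁], ![1 - D, D], ?_, by simp⟩, ?_⟩
  · intro m
    fin_cases m
    exacts [(sub_nonneg.2 h1).posSemidef, h0.posSemidef]
  · intro m
    fin_cases m
    · simpa using h2
    · simpa using h3

/-- The product code on consecutive blocks; maximal errors add by the union bound. -/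
theorem HasCode.mul (hN : IsCPTP N) {m n K K' : ℕ} {e e' : ℝ} (h : HasCode N m K e)
    (h' : HasCode N n K' e') : HasCode N (m + n) (K * K') (e + e') := by
  obtain ⟨C, hC⟩ := h
  obtain ⟨C', hC'⟩ := h'
  let f := (finProdFinEquiv (m := K) (n := K')).symm
  have hone : ∀ m, (0 : Matrix (Fin m → j) (Fin m → j) ℂ) ≤ 1 := fun m => PosSemidef.one.nonneg
  refine ⟨⟨fun k => (C.ρ (f k).1).cat (C'.ρ (f k).2), fun k => cat (C.D (f k).1) (C'.D (f k).2),
    fun k => cat_posSemidef (C.posSemidef _) (C'.posSemidef _), ?_⟩, fun k => ?_⟩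
  · rw [f.sum_comp (fun p => cat (C.D p.1) (C'.D p.2)), Fintype.sum_prod_type]
    simp only [← map_sum, C'.sum_eq_one]
    rw [← LinearMap.sum_apply, ← map_sum, C.sum_eq_one, cat_one_one]
  · refine (eff_cat_one_sub_le hN _ _ (C.D_le_one _) (C'.D_le_one _)).trans ?_
    rw [add_smul]
    refine add_le_add ?_ ?_
    · rw [← cat_smul_one_one]
      have h4 := eff_nonneg hN (C.ρ (f k).1) (sub_nonneg.2 (C.D_le_one (f k).1))
      exact cat_mono (hC _) le_rfl (h4.trans (hC _)) (hone _)
    · rw [← cat_one_smul_one]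
      have h4 := eff_nonneg hN (C'.ρ (f k).2) (sub_nonneg.2 (C'.D_le_one (f k).2))
      exact cat_mono le_rfl (hC' _) (hone _) h4

theorem hasCode_one [Nonempty a] (N : SuperOp (a × j) b) (ℓ : ℕ) : HasCode N ℓ 1 0 :=
  ⟨⟨fun _ => Classical.arbitrary _, fun _ => 1, fun _ => PosSemidef.one, by simp⟩, by simp⟩

theorem HasCode.pow [Nonempty a] (hN : IsCPTP N) {K : ℕ} {e : ℝ} (h : HasCode N ℓ K e) (B : ℕ) :
    HasCode N (B * ℓ) (K ^ B) (B * e) := by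
  induction B with
  | zero => simpa using hasCode_one N _
  | succ B ih =>
    have := ih.mul hN h
    rwa [← Nat.succ_mul, ← pow_succ, show (B * e + e : ℝ) = ((B + 1 : ℕ) : ℝ) * e by
      push_cast; ring] at this

end Tests

/-! ### Classical codes: error operators, extraction of a test, prefixing an index -/

section Classical

variable {a j b : Type*} [Fintype a] [DecidableEq a] [Fintype j] [DecidableEq j] [Fintype b]
  [DecidableEq b] {N : SuperOp (a × j) b} {ℓ M : ℕ}

/-- The error operator of a classical code: its expectation in a jammer state is the error
probability. -/
def ClassicalCode.errOp (C : ClassicalCode a b ℓ M) (N : SuperOp (a × j) b) :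
    Matrix (Fin ℓ → j) (Fin ℓ → j) ℂ :=
  (M : ℝ)⁻¹ • ∑ m, eff N ℓ (C.ρ m).1 (1 - C.D m)

theorem ClassicalCode.err_eq (C : ClassicalCode a b ℓ M) (N : SuperOp (a × j) b)
    (σ : State (Fin ℓ → j)) : C.err N σ = (σ.1 * C.errOp N).trace.re := by
  simp only [ClassicalCode.err, ClassicalCode.errOp, jammed_trace_mul, Matrix.mul_smul,
    Matrix.trace_smul, Matrix.mul_sum, Matrix.trace_sum, Complex.smul_re, Complex.re_sum,
    smul_eq_mul, one_div]

theorem ClassicalCode.errOp_nonneg (hN : IsCPTP N) (C : ClassicalCode a b ℓ M) :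
    0 ≤ C.errOp N :=
  smul_nonneg (by positivity) (Finset.sum_nonneg fun m _ =>
    eff_nonneg hN _ (sub_nonneg.2 (C.D_le_one m)))

/-- Equality fails only for `M = 0`, where the inverse is `0` and the left side vanishes. -/
theorem inv_smul_sum_const_le {n : Type*} [Fintype n] {M : ℕ} {X : Matrix n n ℂ} (hX : 0 ≤ X) :
    (M : ℝ)⁻¹ • ∑ _m : Fin M, X ≤ X := by
  rcases Nat.eq_zero_or_pos M with rfl | hM
  · simpa using hX
  · refine le_of_eq ?_
    have : (M : ℝ) ≠ 0 := by positivity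
    rw [Finset.sum_const, Finset.card_univ, Fintype.card_fin, ← Nat.cast_smul_eq_nsmul ℝ,
      smul_smul, inv_mul_cancel₀ this, one_smul]

theorem ClassicalCode.errOp_le_one (hN : IsCPTP N) (C : ClassicalCode a b ℓ M) :
    C.errOp N ≤ 1 := by
  refine (smul_le_smul_of_nonneg_left (Finset.sum_le_sum fun m _ =>
    eff_le_one hN (C.ρ m) (sub_le_self _ (C.D_nonneg m))) (by positivity)).trans ?_
  exact inv_smul_sum_const_le PosSemidef.one.nonneg

/-- Deciding only whether the message lies in `s` errs no more often than decoding it. Averaging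
over `s` in place of all messages costs the factor `M / s.card`, at most `3`. -/
theorem ClassicalCode.eff_avg_le (hN : IsCPTP N) (C : ClassicalCode a b ℓ M) {ε : ℝ}
    (hε : 0 ≤ ε) (h : C.errOp N ≤ ε • (1 : Matrix (Fin ℓ → j) (Fin ℓ → j) ℂ))
    (s : Finset (Fin M)) (hs : s.Nonempty) (hM : M ≤ 3 * s.card) :
    eff N ℓ (State.avg s hs C.ρ).1 (1 - ∑ m ∈ s, C.D m) ≤
      (3 * ε) • (1 : Matrix (Fin ℓ → j) (Fin ℓ → j) ℂ) := by
  have hc : (0 : ℝ) < s.card := by exact_mod_cast hs.card_pos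
  have hM0 : (0 : ℝ) < M := by
    obtain ⟨m, _⟩ := hs
    exact_mod_cast m.pos
  have h1 : ∑ m, eff N ℓ (C.ρ m).1 (1 - C.D m) ≤
      (M * ε) • (1 : Matrix (Fin ℓ → j) (Fin ℓ → j) ℂ) := by
    have := smul_le_smul_of_nonneg_left h hM0.le
    rwa [ClassicalCode.errOp, smul_smul, mul_inv_cancel₀ hM0.ne', one_smul, smul_smul] at this
  have h2 : ∀ m ∈ s, eff N ℓ (C.ρ m).1 (1 - ∑ m ∈ s, C.D m) ≤
      eff N ℓ (C.ρ m).1 (1 - C.D m) := fun m hm =>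
    eff_mono hN _ (sub_le_sub_left (Finset.single_le_sum (fun m _ => C.D_nonneg m) hm) _)
  have h3 : ∑ m ∈ s, eff N ℓ (C.ρ m).1 (1 - C.D m) ≤ ∑ m, eff N ℓ (C.ρ m).1 (1 - C.D m) :=
    Finset.sum_le_sum_of_subset_of_nonneg (Finset.subset_univ s)
      fun m _ _ => eff_nonneg hN _ (sub_nonneg.2 (C.D_le_one m))
  have h4 : eff N ℓ (State.avg s hs C.ρ).1 (1 - ∑ m ∈ s, C.D m) =
      (s.card : ℝ)⁻¹ • ∑ m ∈ s, eff N ℓ (C.ρ m).1 (1 - ∑ m ∈ s, C.D m) := by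
    change eff N ℓ ((s.card : ℝ)⁻¹ • ∑ k ∈ s, (C.ρ k).1) _ = _
    rw [← Complex.coe_smul, map_smul, LinearMap.smul_apply, Complex.coe_smul, map_sum,
      LinearMap.sum_apply]
  rw [h4]
  refine (smul_le_smul_of_nonneg_left ((Finset.sum_le_sum h2).trans (h3.trans h1))
    (by positivity)).trans ?_
  rw [smul_smul]
  refine smul_le_smul_of_nonneg_right ?_ PosSemidef.one.nonneg
  rw [← mul_assoc]
  refine mul_le_mul_of_nonneg_right ?_ hε
  rw [inv_mul_le_iff₀ hc, mul_comm]
  exact_mod_cast hM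

theorem ClassicalCode.hasTest (hN : IsCPTP N) (C : ClassicalCode a b ℓ M) (hM : 2 ≤ M) {ε : ℝ}
    (hε : 0 ≤ ε) (h : C.errOp N ≤ ε • (1 : Matrix (Fin ℓ → j) (Fin ℓ → j) ℂ)) :
    HasTest N ℓ (3 * ε) (3 * ε) := by
  -- The two halves of the message set become the two hypotheses of the test. The factor `3` is
  -- attained at `M = 3`, where the smaller half has one element.
  let s : Finset (Fin M) := Finset.univ.filter fun m => (m : ℕ) < M / 2
  have hs : s.card = M / 2 := by
    rw [Fin.card_filter_val_lt]
    omega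
  have hs' : sᶜ.card = M - M / 2 := by rw [Finset.card_compl, hs, Fintype.card_fin]
  have hn : s.Nonempty := Finset.card_pos.1 (by omega)
  have hn' : sᶜ.Nonempty := Finset.card_pos.1 (by omega)
  have hsum : 1 - ∑ m ∈ s, C.D m = ∑ m ∈ sᶜ, C.D m := by
    rw [← C.sum_eq_one, sub_eq_iff_eq_add, add_comm, Finset.sum_add_sum_compl]
  have hsum' : 1 - ∑ m ∈ sᶜ, C.D m = ∑ m ∈ s, C.D m := by rw [← hsum, sub_sub_cancel]
  refine ⟨State.avg sᶜ hn' C.ρ, State.avg s hn C.ρ, ∑ m ∈ s, C.D m,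
    Finset.sum_nonneg fun m _ => C.D_nonneg m, ?_, ?_, ?_⟩
  · rw [← sub_nonneg, hsum]
    exact Finset.sum_nonneg fun m _ => C.D_nonneg m
  · rw [← hsum']
    exact C.eff_avg_le hN hε h _ hn' (by omega)
  · exact C.eff_avg_le hN hε h _ hn (by omega)

/-- The code which first sends a uniformly random index `k` with the code `C` and then uses the code
`C' k`. -/
def ClassicalCode.concat {m n K M : ℕ} (hK : 0 < K) (C : ClassicalCode a b m K)
    (C' : Fin K → ClassicalCode a b n M) : ClassicalCode a b (m + n) M where
  ρ i := State.avg Finset.univ ⟨⟨0, hK⟩, Finset.mem_univ _⟩ fun k => (C.ρ k).cat ((C' k).ρ i)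
  D i := ∑ k, cat (C.D k) ((C' k).D i)
  posSemidef i := posSemidef_sum _ fun k _ => cat_posSemidef (C.posSemidef k) ((C' k).posSemidef i)
  sum_eq_one := by
    rw [Finset.sum_comm]
    simp only [← map_sum, (C' _).sum_eq_one]
    rw [← LinearMap.sum_apply, ← map_sum, C.sum_eq_one, cat_one_one]

/-- For each index sent, keep only the decoder term with the same index; the other terms are
positive effects and only help. The union bound then separates the prefix error from the error of
`C' k`. -/
theorem ClassicalCode.eff_concat_le (hN : IsCPTP N) {m n K M : ℕ} (hK : 0 < K) {e : ℝ}
    (he : 0 ≤ e) {C : ClassicalCode a b m K}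
    (hC : ∀ k, eff N m (C.ρ k).1 (1 - C.D k) ≤ e • (1 : Matrix (Fin m → j) (Fin m → j) ℂ))
    (C' : Fin K → ClassicalCode a b n M) (i : Fin M) :
    eff N (m + n) ((C.concat hK C').ρ i).1 (1 - (C.concat hK C').D i) ≤
      e • (1 : Matrix (Fin (m + n) → j) (Fin (m + n) → j) ℂ) +
        cat 1 ((K : ℝ)⁻¹ • ∑ k, eff N n ((C' k).ρ i).1 (1 - (C' k).D i)) := by
  have hone : ∀ m, (0 : Matrix (Fin m → j) (Fin m → j) ℂ) ≤ 1 := fun m => PosSemidef.one.nonneg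
  have h1 : eff N (m + n) ((C.concat hK C').ρ i).1 (1 - (C.concat hK C').D i) =
      (K : ℝ)⁻¹ • ∑ k, eff N (m + n) ((C.ρ k).cat ((C' k).ρ i)).1 (1 - (C.concat hK C').D i) := by
    change eff N (m + n) (((Finset.univ : Finset (Fin K)).card : ℝ)⁻¹ •
      ∑ k, ((C.ρ k).cat ((C' k).ρ i)).1) _ = _
    rw [← Complex.coe_smul, map_smul, LinearMap.smul_apply, Complex.coe_smul, map_sum,
      LinearMap.sum_apply, Finset.card_univ, Fintype.card_fin]
  have h2 : ∀ k, eff N (m + n) ((C.ρ k).cat ((C' k).ρ i)).1 (1 - (C.concat hK C').D i) ≤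
      e • (1 : Matrix (Fin (m + n) → j) (Fin (m + n) → j) ℂ) +
        cat 1 (eff N n ((C' k).ρ i).1 (1 - (C' k).D i)) := by
    intro k
    have h3 : cat (C.D k) ((C' k).D i) ≤ (C.concat hK C').D i :=
      Finset.single_le_sum (f := fun k => cat (C.D k) ((C' k).D i))
        (fun k _ => cat_nonneg (C.D_nonneg k) ((C' k).D_nonneg i)) (Finset.mem_univ k)
    refine (eff_mono hN _ (sub_le_sub_left h3 _)).trans ?_
    refine (eff_cat_one_sub_le hN _ _ (C.D_le_one k) ((C' k).D_le_one i)).trans ?_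
    refine add_le_add ?_ le_rfl
    rw [← cat_smul_one_one]
    exact cat_mono (hC _) le_rfl (smul_nonneg he (hone _)) (hone _)
  rw [h1]
  refine (smul_le_smul_of_nonneg_left (Finset.sum_le_sum fun k _ => h2 k)
    (by positivity)).trans ?_
  rw [Finset.sum_add_distrib, smul_add, ← map_sum]
  refine add_le_add (inv_smul_sum_const_le (smul_nonneg he (hone _))) (le_of_eq ?_)
  rw [← Complex.coe_smul, ← Complex.coe_smul, map_smul]

theorem ClassicalCode.exists_concat (hN : IsCPTP N) {m n K M : ℕ} (hK : 0 < K) {e : ℝ}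
    (he : 0 ≤ e) (hC : HasCode N m K e) (C' : Fin K → ClassicalCode a b n M) :
    ∃ C'' : ClassicalCode a b (m + n) M, C''.errOp N ≤
      e • (1 : Matrix (Fin (m + n) → j) (Fin (m + n) → j) ℂ) +
        cat 1 ((K : ℝ)⁻¹ • ∑ k, (C' k).errOp N) := by
  obtain ⟨C, hC⟩ := hC
  refine ⟨C.concat hK C', ?_⟩
  have h1 := smul_le_smul_of_nonneg_left (Finset.sum_le_sum fun i (_ : i ∈ Finset.univ) =>
    ClassicalCode.eff_concat_le hN hK he hC C' i) (inv_nonneg.2 (Nat.cast_nonneg (α := ℝ) M))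
  rw [Finset.sum_add_distrib, smul_add, ← map_sum] at h1
  refine h1.trans (add_le_add
    (inv_smul_sum_const_le (smul_nonneg he PosSemidef.one.nonneg)) (le_of_eq ?_))
  have h2 : ∑ k, (C' k).errOp N =
      (M : ℝ)⁻¹ • ∑ i, ∑ k, eff N n ((C' k).ρ i).1 (1 - (C' k).D i) := by
    rw [Finset.sum_comm, Finset.smul_sum]
    rfl
  rw [h2, ← Finset.smul_sum, smul_comm (K : ℝ)⁻¹ (M : ℝ)⁻¹, LinearMap.map_smul_of_tower,
    LinearMap.map_smul_of_tower, LinearMap.map_smul_of_tower]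

end Classical

/-! ### Complete positivity of the building blocks of quantum codes -/

section PositiveMaps

theorem posSemidef_of_forall_state {n : Type*} [Fintype n] {A : Matrix n n ℂ}
    (h : ∀ σ : State n, 0 ≤ (σ.1 * A).trace) : A.PosSemidef := by
  refine posSemidef_of_dotProduct_nonneg fun v => ?_
  by_cases hv : v = 0
  · simp [hv]
  obtain ⟨σ, hσ⟩ := exists_state_dotProduct_mulVec hv
  rw [hσ]
  refine mul_nonneg ?_ (h σ)
  exact_mod_cast (Complex.le_def.1 (dotProduct_star_self_nonneg v)).1

theorem IsCP.posSemidef_map {a b : Type*} [Fintype a] [Fintype b] {Φ : SuperOp a b} (h : IsCP Φ)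
    {X : Matrix a a ℂ} (hX : X.PosSemidef) : (Φ X).PosSemidef := by
  classical
  obtain ⟨K, hK⟩ := h.exists_kraus
  rw [hK]
  exact posSemidef_sum _ fun k _ => hX.mul_mul_conjTranspose_same _

/-- The map `ρ ↦ ρ ⊗ σ`. -/
def tensorRight {a s : Type*} (σ : Matrix s s ℂ) : SuperOp a (a × s) where
  toFun ρ := ρ ⊗ₖ σ
  map_add' ρ ρ' := by rw [Matrix.add_kronecker]
  map_smul' t ρ := by rw [Matrix.smul_kronecker, RingHom.id_apply]

theorem isCP_tensorRight {a s : Type*} [Fintype a] [Fintype s] {σ : Matrix s s ℂ}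
    (hσ : σ.PosSemidef) : IsCP (tensorRight (a := a) σ) := by
  intro k X hX
  have h : idTensor (tensorRight σ) X = (X ⊗ₖ σ).submatrix
      (fun p : Fin k × a × s => ((p.1, p.2.1), p.2.2)) fun p => ((p.1, p.2.1), p.2.2) := rfl
  rw [h]
  exact (hX.kronecker hσ).submatrix _

theorem isCP_jammed {a j b : Type*} [Fintype a] [DecidableEq a] [Fintype j] [DecidableEq j]
    [Fintype b] {N : SuperOp (a × j) b} (hN : IsCP N) (ℓ : ℕ) (σ : State (Fin ℓ → j)) :
    IsCP (jammed N ℓ σ) := by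
  obtain ⟨K, hK⟩ := hN.exists_kraus
  obtain ⟨V, hV⟩ := blockChannel_kraus hK ℓ
  have h : jammed N ℓ σ = blockChannel N ℓ ∘ₗ tensorRight σ.1 := rfl
  rw [h]
  exact (IsCP.of_kraus V hV).comp (isCP_tensorRight σ.2.1)

theorem isCP_cat {c : Type*} [Fintype c] {m n : ℕ} {ρ : Matrix (Fin m → c) (Fin m → c) ℂ}
    (hρ : ρ.PosSemidef) :
    IsCP (cat ρ : SuperOp (Fin n → c) (Fin (m + n) → c)) := fun k _ hX =>
  (hρ.kronecker hX).submatrix fun p : Fin k × (Fin (m + n) → c) =>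
    (fun i => p.2 (Fin.castAdd n i), (p.1, fun i => p.2 (Fin.natAdd m i)))

/-- The map `Y ↦ tr₁ ((D ⊗ 1) Y)`. -/
def slice {c : Type*} [Fintype c] {m n : ℕ} (D : Matrix (Fin m → c) (Fin m → c) ℂ) :
    SuperOp (Fin (m + n) → c) (Fin n → c) where
  toFun Y := Matrix.of fun y y' => ∑ z, ∑ z', D z' z * Y (Fin.append z y) (Fin.append z' y')
  map_add' X Y := by
    ext
    simp [mul_add, Finset.sum_add_distrib]
  map_smul' t X := by
    ext
    simp [Finset.mul_sum, mul_left_comm]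

theorem slice_apply {c : Type*} [Fintype c] {m n : ℕ} (D : Matrix (Fin m → c) (Fin m → c) ℂ)
    (Y : Matrix (Fin (m + n) → c) (Fin (m + n) → c) ℂ) (y y' : Fin n → c) :
    slice D Y y y' = ∑ z, ∑ z', D z' z * Y (Fin.append z y) (Fin.append z' y') := rfl

theorem isCP_slice {c : Type*} [Fintype c] {m n : ℕ} {D : Matrix (Fin m → c) (Fin m → c) ℂ}
    (hD : D.PosSemidef) : IsCP (slice D : SuperOp (Fin (m + n) → c) (Fin n → c)) := by
  classical
  obtain ⟨G, rfl⟩ := exists_conjTranspose_mul_self hD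
  -- One Kraus operator for each row of `G`, where `D = Gᴴ * G`: contract the first block with that
  -- row and leave the second block alone.
  refine IsCP.of_kraus (fun g => Matrix.of fun (y : Fin n → c) (x : Fin (m + n) → c) =>
    if (fun i => x (Fin.natAdd m i)) = y then G g (fun i => x (Fin.castAdd n i)) else 0)
    fun Y => ?_
  ext y y'
  simp only [slice_apply, Matrix.sum_apply, Matrix.mul_apply, sum_fin_add, Matrix.of_apply,
    Matrix.conjTranspose_apply, Fin.append_left, Fin.append_right, ite_mul, zero_mul,
    Finset.sum_ite_eq', Finset.mem_univ, if_true, apply_ite star, star_zero, mul_ite, mul_zero,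
    Finset.sum_mul]
  rw [Finset.sum_comm]
  conv_rhs => rw [Finset.sum_comm]
  refine Finset.sum_congr rfl fun z' _ => ?_
  rw [Finset.sum_comm]
  refine Finset.sum_congr rfl fun g _ => Finset.sum_congr rfl fun z _ => ?_
  ring

theorem slice_single {c : Type*} [Fintype c] [DecidableEq c] {m n : ℕ}
    (D : Matrix (Fin m → c) (Fin m → c) ℂ) (z z' : Fin m → c) (y y' : Fin n → c) :
    slice D (Matrix.single (Fin.append z y) (Fin.append z' y') 1) =
      D z' z • Matrix.single y y' (1 : ℂ) := by
  ext x x'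
  simp only [slice_apply, Matrix.single_apply, append_inj_iff, Matrix.smul_apply, smul_eq_mul]
  rw [Finset.sum_eq_single z, Finset.sum_eq_single z']
  · simp
  · intro w _ hw
    simp [hw.symm]
  · simp
  · intro w _ hw
    simp [hw.symm]
  · simp

/-- The maps `slice (D k)` are the branches of an instrument: measure the first block, discard it,
keep the second. Completeness of the measurement preserves the total trace. -/
theorem trace_slice_sum {c κ : Type*} [Fintype c] [DecidableEq c] [Fintype κ] {m n : ℕ}
    {D : κ → Matrix (Fin m → c) (Fin m → c) ℂ} (hD : ∑ k, D k = 1)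
    (Y : Matrix (Fin (m + n) → c) (Fin (m + n) → c) ℂ) :
    ∑ k, (slice (n := n) (D k) Y).trace = Y.trace := by
  have h : ∀ z z', ∑ k, D k z' z = if z' = z then 1 else 0 := by
    intro z z'
    rw [← Matrix.sum_apply, hD, Matrix.one_apply]
  simp only [Matrix.trace, Matrix.diag_apply, slice_apply, sum_fin_add (m := m) (n := n)]
  rw [Finset.sum_comm]
  conv_rhs => rw [Finset.sum_comm]
  refine Finset.sum_congr rfl fun y _ => ?_
  rw [Finset.sum_comm]
  refine Finset.sum_congr rfl fun z _ => ?_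
  rw [Finset.sum_comm]
  simp only [← Finset.sum_mul, h]
  simp

end PositiveMaps

/-! ### Decoders in the Heisenberg picture -/

section Adjoint

variable {b c : Type*} [Fintype b] [DecidableEq b]

/-- The operator `adj i i' Ψ` with `tr (Y · adj i i' Ψ) = ⟨i|Ψ(Y)|i'⟩` for all `Y`. -/
def adj (i i' : c) : SuperOp b c →ₗ[ℂ] Matrix b b ℂ where
  toFun Ψ := Matrix.of fun y' y => Ψ (Matrix.single y y' 1) i i'
  map_add' Ψ Ψ' := by
    ext
    simp
  map_smul' t Ψ := by
    ext
    simp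

theorem adj_apply (i i' : c) (Ψ : SuperOp b c) (y' y : b) :
    adj i i' Ψ y' y = Ψ (Matrix.single y y' 1) i i' := rfl

theorem trace_mul_adj (Ψ : SuperOp b c) (Y : Matrix b b ℂ) (i i' : c) :
    (Y * adj i i' Ψ).trace = Ψ Y i i' := by
  rw [superOp_apply_eq_sum]
  rfl

/-- Pulled back to the output of the channel, measuring the prefix and then decoding the rest is a
product operator, so `eff_cat` applies to it. -/
theorem adj_comp_slice {m n : ℕ} (D : Matrix (Fin m → b) (Fin m → b) ℂ)
    (Ψ : SuperOp (Fin n → b) c) (i i' : c) :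
    adj i i' (Ψ ∘ₗ slice D) = cat D (adj i i' Ψ) := by
  refine matrix_ext_append fun z' z y' y => ?_
  rw [adj_apply, LinearMap.comp_apply, slice_single, cat_append, map_smul, adj_apply,
    Matrix.smul_apply, smul_eq_mul]

end Adjoint

/-! ### The entanglement fidelity as an operator on the jammer system -/

section Fidelity

variable {a j b : Type*} [Fintype a] [DecidableEq a] [Fintype j] [DecidableEq j] [Fintype b]
  [DecidableEq b] {N : SuperOp (a × j) b} {ℓ L : ℕ}

/-- The operator on `J^ℓ` whose expectation in a jammer state is the entanglement fidelity of the
encoder `E` and the decoder `D`. -/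
def fidOp (N : SuperOp (a × j) b) (ℓ L : ℕ) : SuperOp (Fin L) (Fin ℓ → a) →ₗ[ℂ]
    SuperOp (Fin ℓ → b) (Fin L) →ₗ[ℂ] Matrix (Fin ℓ → j) (Fin ℓ → j) ℂ :=
  LinearMap.mk₂ ℂ (fun E D => ((L : ℂ) ^ 2)⁻¹ • ∑ i, ∑ i',
      eff N ℓ (E (Matrix.single i i' 1)) (adj i i' D))
    (fun E E' D => by simp [Finset.sum_add_distrib])
    (fun t E D => by simp [← Finset.smul_sum, smul_comm t])
    (fun E D D' => by simp [Finset.sum_add_distrib])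
    (fun t E D => by simp [← Finset.smul_sum, smul_comm t])

theorem fidOp_apply (E : SuperOp (Fin L) (Fin ℓ → a)) (D : SuperOp (Fin ℓ → b) (Fin L)) :
    fidOp N ℓ L E D = ((L : ℂ) ^ 2)⁻¹ • ∑ i, ∑ i',
      eff N ℓ (E (Matrix.single i i' 1)) (adj i i' D) := rfl

theorem trace_mul_eff_adj (E : SuperOp (Fin L) (Fin ℓ → a)) (D : SuperOp (Fin ℓ → b) (Fin L))
    (σ : State (Fin ℓ → j)) (i i' : Fin L) :
    (σ.1 * eff N ℓ (E (Matrix.single i i' 1)) (adj i i' D)).trace =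
      (D ∘ₗ jammed N ℓ σ ∘ₗ E) (Matrix.single i i' 1) i i' := by
  rw [← jammed_trace_mul, trace_mul_adj]
  rfl

theorem trace_mul_fidOp (E : SuperOp (Fin L) (Fin ℓ → a)) (D : SuperOp (Fin ℓ → b) (Fin L))
    (σ : State (Fin ℓ → j)) :
    (σ.1 * fidOp N ℓ L E D).trace = ((L : ℂ) ^ 2)⁻¹ * ∑ i, ∑ i',
      (D ∘ₗ jammed N ℓ σ ∘ₗ E) (Matrix.single i i' 1) i i' := by
  simp only [fidOp_apply, Matrix.mul_smul, Matrix.trace_smul, Matrix.mul_sum, Matrix.trace_sum,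
    trace_mul_eff_adj, smul_eq_mul]

theorem trace_idTensor_maxEntangled (T : SuperOp (Fin L) (Fin L)) :
    (idTensor T (maxEntangled L) * maxEntangled L).trace =
      ((L : ℂ) ^ 2)⁻¹ * ∑ i, ∑ i', T (Matrix.single i i' 1) i i' := by
  have h : ∀ p q, idTensor T (maxEntangled L) p q =
      (L : ℂ)⁻¹ * T (Matrix.single p.1 q.1 1) p.2 q.2 := by
    intro p q
    have : (Matrix.of fun x y => maxEntangled L (p.1, x) (q.1, y)) =
        (L : ℂ)⁻¹ • Matrix.single p.1 q.1 (1 : ℂ) := by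
      ext x y
      simp [maxEntangled, Matrix.single_apply]
    simp only [idTensor, Matrix.of_apply]
    rw [this, map_smul, Matrix.smul_apply, smul_eq_mul]
  simp only [Matrix.trace, Matrix.diag_apply, Matrix.mul_apply, h, Fintype.sum_prod_type]
  simp only [maxEntangled, Matrix.of_apply, ite_and, mul_ite, mul_zero, Finset.sum_ite_irrel,
    Finset.sum_const_zero, Finset.sum_ite_eq, Finset.mem_univ, if_true, Finset.mul_sum]
  refine Finset.sum_congr rfl fun i _ => Finset.sum_congr rfl fun i' _ => ?_
  rw [sq, mul_inv]
  ring

theorem IsCP.diag_posSemidef {T : SuperOp (Fin L) (Fin L)} (h : IsCP T) :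
    (Matrix.of fun i i' : Fin L => T (Matrix.single i i' 1) i i').PosSemidef :=
  h.choi_posSemidef.submatrix fun i : Fin L => (i, i)

theorem sum_entries_nonneg {S : Matrix (Fin L) (Fin L) ℂ} (h : S.PosSemidef) :
    0 ≤ ∑ i, ∑ i', S i i' := by
  have := h.dotProduct_mulVec_nonneg 1
  simpa [dotProduct, Matrix.mulVec] using this

/-- Evaluate the form of `S` at the differences of basis vectors `e_i - e_i'` and sum over all
pairs; this gives twice the difference of the two sides. -/
theorem sum_entries_le {S : Matrix (Fin L) (Fin L) ℂ} (h : S.PosSemidef) :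
    ∑ i, ∑ i', S i i' ≤ L * ∑ i, S i i := by
  have h1 : ∀ i i', 0 ≤ S i i + S i' i' - S i i' - S i' i := by
    intro i i'
    have := h.dotProduct_mulVec_nonneg (Pi.single i 1 - Pi.single i' 1)
    rw [Matrix.mulVec_sub, Matrix.mulVec_single_one, Matrix.mulVec_single_one] at this
    simp only [star_sub, Pi.star_single, star_one, sub_dotProduct, dotProduct_sub,
      single_one_dotProduct, Matrix.col_apply] at this
    convert this using 1
    ring
  have h2 : 0 ≤ ∑ i, ∑ i', (S i i + S i' i' - S i i' - S i' i) :=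
    Finset.sum_nonneg fun i _ => Finset.sum_nonneg fun i' _ => h1 i i'
  have h3 : ∑ i, ∑ i', (S i i + S i' i' - S i i' - S i' i) =
      2 * (L * ∑ i, S i i - ∑ i, ∑ i', S i i') := by
    simp only [Finset.sum_sub_distrib, Finset.sum_add_distrib, Finset.sum_const, Finset.card_univ,
      Fintype.card_fin, nsmul_eq_mul, ← Finset.mul_sum]
    rw [Finset.sum_comm (f := fun i i' => S i' i)]
    ring
  rw [h3] at h2
  have h4 := smul_nonneg (show (0 : ℝ) ≤ 1 / 2 by norm_num) h2
  rw [← Complex.coe_smul, smul_eq_mul, ← mul_assoc] at h4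
  exact sub_nonneg.1 (by simpa using h4)

theorem fidOp_nonneg (hN : IsCP N) {E : SuperOp (Fin L) (Fin ℓ → a)}
    {D : SuperOp (Fin ℓ → b) (Fin L)} (hE : IsCP E) (hD : IsCP D) : 0 ≤ fidOp N ℓ L E D := by
  refine (posSemidef_of_forall_state fun σ => ?_).nonneg
  rw [trace_mul_fidOp]
  refine mul_nonneg (inv_nonneg.2 (by positivity)) ?_
  exact sum_entries_nonneg (hD.comp ((isCP_jammed hN ℓ σ).comp hE)).diag_posSemidef

/-- Entanglement fidelity is at most the average success probability on basis states. For each `σ`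
this is `sum_entries_le` applied to a principal submatrix of the Choi matrix of the whole
transmission. -/
theorem fidOp_le (hN : IsCP N) {E : SuperOp (Fin L) (Fin ℓ → a)}
    {D : SuperOp (Fin ℓ → b) (Fin L)} (hE : IsCP E) (hD : IsCP D) :
    fidOp N ℓ L E D ≤ (L : ℝ)⁻¹ • ∑ i, eff N ℓ (E (Matrix.single i i 1)) (adj i i D) := by
  rcases Nat.eq_zero_or_pos L with rfl | hL
  · simp [fidOp_apply]
  have hL' : (L : ℂ) ≠ 0 := by exact_mod_cast hL.ne'
  rw [Matrix.le_iff]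
  refine posSemidef_of_forall_state fun σ => ?_
  have h := sum_entries_le (hD.comp ((isCP_jammed hN ℓ σ).comp hE)).diag_posSemidef
  rw [mul_sub, Matrix.trace_sub, trace_mul_fidOp, sub_nonneg]
  simp only [Matrix.mul_smul, Matrix.trace_smul, Matrix.mul_sum, Matrix.trace_sum,
    trace_mul_eff_adj]
  refine (mul_le_mul_of_nonneg_left h (inv_nonneg.2 (by positivity))).trans_eq ?_
  rw [← Complex.coe_smul, smul_eq_mul, ← mul_assoc]
  congr 1
  push_cast
  field_simp

/-- The infidelity operator of a quantum code. -/
def QuantumCode.infidOp (Q : QuantumCode a b ℓ L) (N : SuperOp (a × j) b) :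
    Matrix (Fin ℓ → j) (Fin ℓ → j) ℂ :=
  1 - fidOp N ℓ L Q.E Q.D

theorem QuantumCode.infid_eq (Q : QuantumCode a b ℓ L) (N : SuperOp (a × j) b)
    (σ : State (Fin ℓ → j)) : Q.infid N σ = (σ.1 * Q.infidOp N).trace.re := by
  rw [QuantumCode.infidOp, mul_sub, Matrix.trace_sub, Matrix.mul_one, σ.2.2, trace_mul_fidOp,
    ← trace_idTensor_maxEntangled]
  rfl

theorem QuantumCode.infidOp_le_one (hN : IsCPTP N) (Q : QuantumCode a b ℓ L) :
    Q.infidOp N ≤ 1 :=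
  sub_le_self _ (fidOp_nonneg hN.isCP Q.isCPTP_E.isCP Q.isCPTP_D.isCP)

/-- The classical code which sends the basis states through a quantum code. -/
def QuantumCode.toClassical (Q : QuantumCode a b ℓ L) : ClassicalCode a b ℓ L where
  ρ i := ⟨Q.E (Matrix.single i i 1), Q.isCPTP_E.isCP.posSemidef_map (posSemidef_single i),
    by rw [Q.isCPTP_E.tracePreserving]; simp⟩
  D i := adj i i Q.D
  posSemidef i := posSemidef_of_trace_mul_nonneg fun X hX => by
    rw [trace_mul_adj]
    exact (Q.isCPTP_D.isCP.posSemidef_map hX).diag_nonneg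
  sum_eq_one := by
    ext y' y
    have := Q.isCPTP_D.tracePreserving (Matrix.single y y' 1)
    simp only [Matrix.sum_apply, adj_apply]
    simp only [Matrix.trace, Matrix.diag_apply] at this
    rw [this]
    simp [Matrix.single_apply, Matrix.one_apply, ite_and]

theorem QuantumCode.errOp_toClassical_le (hN : IsCPTP N) (Q : QuantumCode a b ℓ L) :
    Q.toClassical.errOp N ≤ Q.infidOp N := by
  have h := fidOp_le hN.isCP Q.isCPTP_E.isCP Q.isCPTP_D.isCP (ℓ := ℓ) (L := L)
  have h1 : ∀ i, eff N ℓ (Q.toClassical.ρ i).1 (1 - Q.toClassical.D i) =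
      1 - eff N ℓ (Q.E (Matrix.single i i 1)) (adj i i Q.D) := by
    intro i
    rw [map_sub, eff_state_one hN]
    rfl
  rw [ClassicalCode.errOp, Finset.sum_congr rfl fun i _ => h1 i, Finset.sum_sub_distrib, smul_sub]
  exact sub_le_sub (inv_smul_sum_const_le PosSemidef.one.nonneg) h

theorem QuantumCode.infidOp_nonneg (hN : IsCPTP N) (Q : QuantumCode a b ℓ L) :
    0 ≤ Q.infidOp N :=
  (Q.toClassical.errOp_nonneg hN).trans (Q.errOp_toClassical_le hN)

end Fidelity

/-! ### Prefixing a classical index to a family of quantum codes -/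

section QuantumConcat

variable {a j b : Type*} [Fintype a] [DecidableEq a] [Fintype j] [DecidableEq j] [Fintype b]
  [DecidableEq b] {N : SuperOp (a × j) b} {ℓ L : ℕ}

/-- The quantum code which first sends a uniformly random index `k` with the classical code `C` and
then uses the quantum code `Q k`. -/
def QuantumCode.concat {m n K L : ℕ} (hK : 0 < K) (C : ClassicalCode a b m K)
    (Q : Fin K → QuantumCode a b n L) : QuantumCode a b (m + n) L where
  E := (K : ℂ)⁻¹ • ∑ k, cat (C.ρ k).1 ∘ₗ (Q k).E
  D := ∑ k, (Q k).D ∘ₗ slice (C.D k)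
  isCPTP_E :=
    { completelyPositive := IsCP.smul (IsCP.sum fun k _ =>
        (isCP_cat (C.ρ k).2.1).comp (Q k).isCPTP_E.isCP) (inv_nonneg.2 (by positivity))
      tracePreserving := fun X => by
        have hK' : (K : ℂ) ≠ 0 := by exact_mod_cast hK.ne'
        have h : ∀ k, (cat (C.ρ k).1 ((Q k).E X)).trace = X.trace := fun k => by
          rw [trace_cat, (C.ρ k).2.2, one_mul, (Q k).isCPTP_E.tracePreserving]
        simp [LinearMap.sum_apply, Matrix.trace_sum, h, hK'] }
  isCPTP_D :=
    { completelyPositive := IsCP.sum fun k _ =>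
        (Q k).isCPTP_D.isCP.comp (isCP_slice (C.posSemidef k))
      tracePreserving := fun Y => by
        rw [← trace_slice_sum C.sum_eq_one Y]
        simp [LinearMap.sum_apply, Matrix.trace_sum, (Q _).isCPTP_D.tracePreserving] }

theorem fidOp_cat {m n L : ℕ} (ρ : Matrix (Fin m → a) (Fin m → a) ℂ)
    (D₁ : Matrix (Fin m → b) (Fin m → b) ℂ) (E : SuperOp (Fin L) (Fin n → a))
    (D : SuperOp (Fin n → b) (Fin L)) :
    fidOp N (m + n) L (cat ρ ∘ₗ E) (D ∘ₗ slice D₁) = cat (eff N m ρ D₁) (fidOp N n L E D) := by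
  simp only [fidOp_apply, adj_comp_slice, LinearMap.comp_apply, eff_cat, map_smul, map_sum]

theorem QuantumCode.exists_concat (hN : IsCPTP N) {m n K L : ℕ} (hK : 0 < K) {e : ℝ}
    (he : 0 ≤ e) (hC : HasCode N m K e) (Q : Fin K → QuantumCode a b n L) :
    ∃ Q' : QuantumCode a b (m + n) L, Q'.infidOp N ≤
      e • (1 : Matrix (Fin (m + n) → j) (Fin (m + n) → j) ℂ) +
        cat 1 ((K : ℝ)⁻¹ • ∑ k, (Q k).infidOp N) := by
  obtain ⟨C, hC⟩ := hC
  have hone : ∀ m, (0 : Matrix (Fin m → j) (Fin m → j) ℂ) ≤ 1 := fun m => PosSemidef.one.nonneg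
  have hK' : (K : ℝ) ≠ 0 := by exact_mod_cast hK.ne'
  refine ⟨QuantumCode.concat hK C Q, ?_⟩
  -- The contribution when `k` is sent and `k'` is decoded. By linearity the fidelity is the sum of
  -- all of these divided by `K`; the terms with `k' ≠ k` are nonnegative and are dropped below.
  let X : Fin K → Fin K → Matrix (Fin (m + n) → j) (Fin (m + n) → j) ℂ := fun k k' =>
    fidOp N (m + n) L (cat (C.ρ k).1 ∘ₗ (Q k).E) ((Q k').D ∘ₗ slice (C.D k'))
  have hX : ∀ k k', 0 ≤ X k k' := fun k k' => fidOp_nonneg hN.isCP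
    ((isCP_cat (C.ρ k).2.1).comp (Q k).isCPTP_E.isCP)
    ((Q k').isCPTP_D.isCP.comp (isCP_slice (C.posSemidef k')))
  have h1 : fidOp N (m + n) L (QuantumCode.concat hK C Q).E (QuantumCode.concat hK C Q).D =
      (K : ℝ)⁻¹ • ∑ k, ∑ k', X k k' := by
    change fidOp N (m + n) L ((K : ℂ)⁻¹ • ∑ k, cat (C.ρ k).1 ∘ₗ (Q k).E)
      (∑ k, (Q k).D ∘ₗ slice (C.D k)) = _
    rw [← Complex.coe_smul]
    simp only [map_smul, map_sum, LinearMap.smul_apply, LinearMap.sum_apply, X, Complex.ofReal_inv,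
      Complex.ofReal_natCast]
    rw [Finset.sum_comm, Finset.smul_sum]
  have h2 : ∀ k, 1 - ∑ k', X k k' ≤ e • (1 : Matrix (Fin (m + n) → j) (Fin (m + n) → j) ℂ) +
      cat 1 ((Q k).infidOp N) := by
    intro k
    have h3 : X k k ≤ ∑ k', X k k' :=
      Finset.single_le_sum (fun k' _ => hX k k') (Finset.mem_univ k)
    have h4 : X k k = cat (eff N m (C.ρ k).1 (C.D k)) (fidOp N n L (Q k).E (Q k).D) :=
      fidOp_cat _ _ _ _
    have h5 : fidOp N n L (Q k).E (Q k).D ≤ 1 := sub_nonneg.1 ((Q k).infidOp_nonneg hN)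
    have h6 : 1 - eff N m (C.ρ k).1 (C.D k) ≤ e • (1 : Matrix (Fin m → j) (Fin m → j) ℂ) := by
      have := hC k
      rwa [map_sub, eff_state_one hN] at this
    refine (sub_le_sub_left (h4 ▸ h3) 1).trans
      ((one_sub_cat_le (eff_le_one hN _ (C.D_le_one k)) h5).trans (add_le_add ?_ le_rfl))
    rw [← cat_smul_one_one]
    exact cat_mono h6 le_rfl (smul_nonneg he (hone _)) (hone _)
  have h7 := smul_le_smul_of_nonneg_left (Finset.sum_le_sum fun k (_ : k ∈ Finset.univ) => h2 k)
    (inv_nonneg.2 (Nat.cast_nonneg (α := ℝ) K))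
  have h8 : (K : ℝ)⁻¹ • ∑ k, (1 - ∑ k', X k k') = (QuantumCode.concat hK C Q).infidOp N := by
    rw [QuantumCode.infidOp, h1, Finset.sum_sub_distrib, smul_sub, Finset.sum_const,
      Finset.card_univ, Fintype.card_fin, ← Nat.cast_smul_eq_nsmul ℝ, smul_smul,
      inv_mul_cancel₀ hK', one_smul]
  rw [h8, Finset.sum_add_distrib, smul_add, ← map_sum] at h7
  refine h7.trans (add_le_add (inv_smul_sum_const_le (smul_nonneg he (hone _))) (le_of_eq ?_))
  rw [LinearMap.map_smul_of_tower]

/-- The quantum code for a one-dimensional system. -/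
def QuantumCode.trivial (ρ : State (Fin ℓ → a)) : QuantumCode a b ℓ 1 where
  E := LinearMap.smulRight (Matrix.entryLinearMap ℂ ℂ (0 : Fin 1) (0 : Fin 1)) ρ.1
  D := LinearMap.smulRight (Matrix.traceLinearMap (Fin ℓ → b) ℂ ℂ) 1
  isCPTP_E :=
    { completelyPositive := fun k X hX => by
        have h := (hX.kronecker ρ.2.1).submatrix
          fun p : Fin k × (Fin ℓ → a) => ((p.1, (0 : Fin 1)), p.2)
        exact h
      tracePreserving := fun X => by
        rw [LinearMap.smulRight_apply, Matrix.trace_smul, ρ.2.2]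
        simp [Matrix.trace] }
  isCPTP_D :=
    { completelyPositive := fun k X hX => by
        have h := posSemidef_sum Finset.univ fun (y : Fin ℓ → b) _ =>
          hX.submatrix fun p : Fin k × Fin 1 => (p.1, y)
        convert h using 1
        ext p q
        have : (1 : Matrix (Fin 1) (Fin 1) ℂ) p.2 q.2 = 1 := by
          rw [Subsingleton.elim p.2 q.2, Matrix.one_apply_eq]
        simp [idTensor, Matrix.trace, Matrix.sum_apply, this]
      tracePreserving := fun X => by
        simp [Matrix.trace] }

theorem QuantumCode.infidOp_trivial (hN : IsCPTP N) (ρ : State (Fin ℓ → a)) :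
    (QuantumCode.trivial ρ : QuantumCode a b ℓ 1).infidOp N = 0 := by
  have h1 : (QuantumCode.trivial ρ : QuantumCode a b ℓ 1).E (Matrix.single 0 0 1) = ρ.1 := by
    simp [QuantumCode.trivial]
  have h2 : adj 0 0 (QuantumCode.trivial ρ : QuantumCode a b ℓ 1).D = 1 := by
    ext y' y
    simp [adj_apply, QuantumCode.trivial, Matrix.trace, Matrix.single_apply, Matrix.one_apply,
      ite_and]
  rw [QuantumCode.infidOp, fidOp_apply]
  simp [h1, h2, eff_state_one hN]

end QuantumConcat

/-! ### Counting words without isolated letters -/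

section Counting

theorem exists_comp_eq {m p K : ℕ} (hm : 0 < m) (g : Fin m → Fin K)
    (h : (Finset.univ.image g).card ≤ p) :
    ∃ (u : Fin p → Fin K) (v : Fin m → Fin p), u ∘ v = g := by
  have hne : Nonempty (Finset.univ.image g) :=
    ⟨⟨g ⟨0, hm⟩, Finset.mem_image_of_mem _ (Finset.mem_univ _)⟩⟩
  obtain ⟨e⟩ : Nonempty (Finset.univ.image g ↪ Fin p) :=
    Function.Embedding.nonempty_of_card_le (by rwa [Fintype.card_coe, Fintype.card_fin])
  -- The image of `g` embeds into `Fin p`; the values of `u` off the image of this embedding are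
  -- arbitrary.
  refine ⟨fun i => (Function.invFun e i).1,
    fun t => e ⟨g t, Finset.mem_image_of_mem _ (Finset.mem_univ _)⟩, ?_⟩
  ext t
  simp [Function.leftInverse_invFun e.injective _]

/-- A bound on the number of words of length `2 p` in `K` letters in which no letter occurs exactly
once. -/
theorem card_words_le (p K : ℕ) (hp : 0 < p) :
    (Finset.univ.filter fun g : Fin (2 * p) → Fin K =>
      ∀ t, ∃ t', t' ≠ t ∧ g t' = g t).card ≤ K ^ p * p ^ (2 * p) := by
  have hsub : (Finset.univ.filter fun g : Fin (2 * p) → Fin K =>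
      ∀ t, ∃ t', t' ≠ t ∧ g t' = g t) ⊆
      Finset.univ.image fun q : (Fin p → Fin K) × (Fin (2 * p) → Fin p) => q.1 ∘ q.2 := by
    intro g hg
    rw [Finset.mem_filter] at hg
    -- Every letter that occurs does so at least twice, so the word uses at most `p` letters and
    -- factors through `Fin p`.
    have h1 : 2 * (Finset.univ.image g).card ≤ (Finset.univ : Finset (Fin (2 * p))).card := by
      refine Finset.mul_card_image_le_card _ 2 fun k hk => ?_
      obtain ⟨t, -, rfl⟩ := Finset.mem_image.1 hk
      obtain ⟨t', ht', h'⟩ := hg.2 t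
      exact Finset.one_lt_card.2 ⟨t, by simp, t', by simp [h'], ht'.symm⟩
    obtain ⟨u, v, huv⟩ := exists_comp_eq (p := p) (by omega) g
      (by simpa using h1)
    exact Finset.mem_image.2 ⟨(u, v), Finset.mem_univ _, huv⟩
  refine (Finset.card_le_card hsub).trans (Finset.card_image_le.trans ?_)
  simp

end Counting

/-! ### The trace moment method for sums of independent matrices -/

section Moments

open scoped Matrix.Norms.L2Operator

variable {n ι : Type*} [Fintype n] [DecidableEq n] [Fintype ι]

/-- When the weights are probabilities, this sum is the expectation of a product of independent
centred matrices. The letter `g t` occurs only at `t`, so summing over its value first replaces that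
factor by the mean, which is `0`. -/
theorem sum_word_eq_zero {w : ι → ℝ} {Y : ι → Matrix n n ℂ} (h0 : ∑ i, w i • Y i = 0)
    {m K : ℕ} (g : Fin m → Fin K) (t : Fin m) (ht : ∀ t', t' ≠ t → g t' ≠ g t) :
    ∑ f : Fin K → ι, (∏ k, w (f k)) •
      MultilinearMap.mkPiAlgebraFin ℝ m (Matrix n n ℂ) (fun s => Y (f (g s))) = 0 := by
  classical
  -- Separate the value `i` drawn for the letter `g t` from the values `f'` of the other letters.
  rw [← (Equiv.funSplitAt (g t) ι).symm.sum_comp, Fintype.sum_prod_type, Finset.sum_comm]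
  refine Finset.sum_eq_zero fun f' _ => ?_
  let Z : Fin m → Matrix n n ℂ := fun s => if h : g s = g t then 0 else Y (f' ⟨g s, h⟩)
  have h1 : ∀ i, (fun s => Y ((Equiv.funSplitAt (g t) ι).symm (i, f') (g s))) =
      Function.update Z t (Y i) := by
    intro i
    funext s
    by_cases hs : s = t
    · subst hs
      simp [Equiv.funSplitAt, Equiv.piSplitAt]
    · have := ht s hs
      simp [Equiv.funSplitAt, Equiv.piSplitAt, Function.update_of_ne hs, Z, this]
  have h2 : ∀ i, ∏ k, w ((Equiv.funSplitAt (g t) ι).symm (i, f') k) =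
      (∏ k : {k // k ≠ g t}, w (f' k)) * w i := by
    intro i
    rw [Fintype.prod_eq_mul_prod_subtype_ne _ (g t), mul_comm]
    congr 1
    · refine Finset.prod_congr rfl fun k _ => ?_
      simp [Equiv.funSplitAt, Equiv.piSplitAt, k.2]
    · simp [Equiv.funSplitAt, Equiv.piSplitAt]
  simp only [h1, h2, mul_smul, ← Finset.smul_sum]
  rw [← Finset.sum_congr rfl fun i _ => MultilinearMap.map_update_smul _ Z t (w i) (Y i),
    ← MultilinearMap.map_update_sum, h0, MultilinearMap.map_coord_zero _ t (by simp), smul_zero]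

theorem norm_trace_le (X : Matrix n n ℂ) : ‖X.trace‖ ≤ Fintype.card n * ‖X‖ := by
  have h : ∀ i, ‖X i i‖ ≤ ‖X‖ := by
    intro i
    have h1 := Matrix.l2_opNorm_mulVec X (EuclideanSpace.single i 1)
    rw [PiLp.norm_single, norm_one, mul_one] at h1
    have h2 := PiLp.norm_apply_le (WithLp.toLp 2 (X *ᵥ (EuclideanSpace.single i (1 : ℂ)).ofLp)) i
    refine le_trans (le_of_eq ?_) (h2.trans h1)
    simp
  calc ‖X.trace‖ ≤ ∑ i, ‖X i i‖ := norm_sum_le _ _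
    _ ≤ ∑ _i : n, ‖X‖ := Finset.sum_le_sum fun i _ => h i
    _ = _ := by simp

theorem norm_word_le {m : ℕ} {Z : Fin m → Matrix n n ℂ} (hZ : ∀ t, ‖Z t‖ ≤ 2) :
    ‖MultilinearMap.mkPiAlgebraFin ℝ m (Matrix n n ℂ) Z‖ ≤ 2 ^ m := by
  rcases isEmpty_or_nonempty n with hn | hn
  · rw [Subsingleton.elim (MultilinearMap.mkPiAlgebraFin ℝ m (Matrix n n ℂ) Z) 0, norm_zero]
    positivity
  rw [MultilinearMap.mkPiAlgebraFin_apply]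
  refine (List.norm_prod_le _).trans ?_
  rw [List.map_ofFn, List.prod_ofFn]
  refine (Finset.prod_le_prod (fun _ _ => norm_nonneg _) fun t _ => hZ t).trans_eq ?_
  simp

/-- The right side bounds the mean over independent draws: at most `K ^ p * p ^ (2 * p)` words
survive `sum_word_eq_zero`, and each has trace at most the dimension times `2 ^ (2 * p)`. Some draw
does no worse than the mean. -/
theorem exists_trace_pow_le {w : ι → ℝ} (hw0 : ∀ i, 0 ≤ w i) (hw1 : ∑ i, w i = 1)
    {Y : ι → Matrix n n ℂ} (hY : ∀ i, ‖Y i‖ ≤ 2) (h0 : ∑ i, w i • Y i = 0) {p : ℕ} (hp : 0 < p)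
    (K : ℕ) :
    ∃ f : Fin K → ι, ((∑ k, Y (f k)) ^ (2 * p)).trace.re ≤
      Fintype.card n * (4 * p ^ 2 * K) ^ p := by
  classical
  set B : ℝ := Fintype.card n * (4 * p ^ 2 * K) ^ p with hB
  have hP : ∑ f : Fin K → ι, ∏ k, w (f k) = 1 := by
    rw [← Fintype.piFinset_univ, ← Finset.prod_univ_sum (fun _ => Finset.univ) fun _ i => w i]
    simp [hw1]
  let F : (Fin (2 * p) → Fin K) → (Fin K → ι) → Matrix n n ℂ := fun g f =>
    MultilinearMap.mkPiAlgebraFin ℝ (2 * p) (Matrix n n ℂ) (fun s => Y (f (g s)))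
  have hexp : ∀ f : Fin K → ι, (∑ k, Y (f k)) ^ (2 * p) = ∑ g, F g f := by
    intro f
    have h1 : (∑ k, Y (f k)) ^ (2 * p) = MultilinearMap.mkPiAlgebraFin ℝ (2 * p) (Matrix n n ℂ)
        (fun _ => ∑ k, Y (f k)) := by
      simp [MultilinearMap.mkPiAlgebraFin_apply]
    rw [h1, MultilinearMap.map_sum]
  have hg : ∀ g, (∑ f, (∏ k, w (f k)) • F g f).trace.re ≤
      if (∀ t, ∃ t', t' ≠ t ∧ g t' = g t) then (Fintype.card n * 2 ^ (2 * p) : ℝ) else 0 := by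
    intro g
    split_ifs with hg
    · refine (Complex.re_le_norm _).trans ((norm_trace_le _).trans ?_)
      refine mul_le_mul_of_nonneg_left ?_ (by positivity)
      refine (norm_sum_le _ _).trans ?_
      calc ∑ f, ‖(∏ k, w (f k)) • F g f‖ ≤ ∑ f : Fin K → ι, (∏ k, w (f k)) * 2 ^ (2 * p) := by
            refine Finset.sum_le_sum fun f _ => ?_
            have hf : 0 ≤ ∏ k, w (f k) := Finset.prod_nonneg fun k _ => hw0 _
            rw [norm_smul, Real.norm_of_nonneg hf]
            exact mul_le_mul_of_nonneg_left (norm_word_le fun s => hY _) hf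
        _ = 2 ^ (2 * p) := by rw [← Finset.sum_mul, hP, one_mul]
    · push Not at hg
      obtain ⟨t, ht⟩ := hg
      rw [show ∑ f, (∏ k, w (f k)) • F g f = 0 from sum_word_eq_zero h0 g t ht]
      simp
  have hE : ∑ f : Fin K → ι, (∏ k, w (f k)) * ((∑ k, Y (f k)) ^ (2 * p)).trace.re ≤ B := by
    have h1 : ∑ f : Fin K → ι, (∏ k, w (f k)) * ((∑ k, Y (f k)) ^ (2 * p)).trace.re =
        ∑ g, (∑ f, (∏ k, w (f k)) • F g f).trace.re := by
      simp only [hexp, Matrix.trace_sum, Matrix.trace_smul, Complex.re_sum, Complex.smul_re,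
        smul_eq_mul, Finset.mul_sum]
      exact Finset.sum_comm
    rw [h1]
    refine (Finset.sum_le_sum fun g _ => hg g).trans ?_
    rw [← Finset.sum_filter, Finset.sum_const, nsmul_eq_mul]
    have h2 : ((Finset.univ.filter fun g : Fin (2 * p) → Fin K =>
        ∀ t, ∃ t', t' ≠ t ∧ g t' = g t).card : ℝ) ≤ K ^ p * p ^ (2 * p) := by
      exact_mod_cast card_words_le p K hp
    refine (mul_le_mul_of_nonneg_right h2 (by positivity)).trans_eq ?_
    rw [hB, mul_pow, mul_pow, pow_mul, pow_mul]
    norm_num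
    ring
  by_contra! hcon
  have h3 : B < B := by
    calc B = ∑ f : Fin K → ι, (∏ k, w (f k)) * B := by rw [← Finset.sum_mul, hP, one_mul]
      _ < ∑ f : Fin K → ι, (∏ k, w (f k)) * ((∑ k, Y (f k)) ^ (2 * p)).trace.re := by
        have hnn : ∀ f : Fin K → ι, 0 ≤ ∏ k, w (f k) := fun f => Finset.prod_nonneg fun k _ => hw0 _
        obtain ⟨f, -, hf⟩ : ∃ f ∈ (Finset.univ : Finset (Fin K → ι)), ∏ k, w (f k) ≠ 0 :=
          Finset.exists_ne_zero_of_sum_ne_zero (by rw [hP]; exact one_ne_zero)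
        refine Finset.sum_lt_sum (fun f _ => mul_le_mul_of_nonneg_left (hcon f).le (hnn f))
          ⟨f, Finset.mem_univ _, mul_lt_mul_of_pos_left (hcon f) (lt_of_le_of_ne (hnn f) hf.symm)⟩
      _ ≤ B := hE
  exact lt_irrefl _ h3

/-- The trace is the sum of the even powers of the eigenvalues, so it dominates each of them
separately. -/
theorem le_smul_one_of_trace_pow_le {T : Matrix n n ℂ} (hT : T.IsHermitian) {c : ℝ} (hc : 0 ≤ c)
    {p : ℕ} (hp : 0 < p) (h : (T ^ (2 * p)).trace.re ≤ c ^ (2 * p)) :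
    T ≤ c • (1 : Matrix n n ℂ) := by
  set φ := Unitary.conjStarAlgAut ℂ (Matrix n n ℂ) hT.eigenvectorUnitary with hφ
  have hs : T = φ (Matrix.diagonal (RCLike.ofReal ∘ hT.eigenvalues)) := hT.spectral_theorem
  have htr : (T ^ (2 * p)).trace.re = ∑ i, hT.eigenvalues i ^ (2 * p) := by
    conv_lhs => rw [hs]
    rw [← map_pow, hφ, Unitary.conjStarAlgAut_apply, Matrix.trace_mul_cycle,
      Unitary.coe_star_mul_self, one_mul, Matrix.diagonal_pow, Matrix.trace_diagonal,
      Complex.re_sum]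
    refine Finset.sum_congr rfl fun i _ => ?_
    simp [← Complex.ofReal_pow]
  have hle : ∀ i, hT.eigenvalues i ≤ c := by
    intro i
    have h1 : hT.eigenvalues i ^ (2 * p) ≤ c ^ (2 * p) := by
      refine le_trans ?_ (htr ▸ h)
      exact Finset.single_le_sum (f := fun i => hT.eigenvalues i ^ (2 * p))
        (fun i _ => (even_two_mul p).pow_nonneg _) (Finset.mem_univ i)
    have h2 : |hT.eigenvalues i| ^ (2 * p) ≤ c ^ (2 * p) := by
      rwa [(even_two_mul p).pow_abs]
    exact (le_abs_self _).trans (le_of_pow_le_pow_left₀ (by omega) hc h2)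
  have hdiag : (Matrix.diagonal fun i => ((c - hT.eigenvalues i : ℝ) : ℂ)).PosSemidef := by
    refine PosSemidef.diagonal fun i => ?_
    have := sub_nonneg.2 (hle i)
    simpa using (by exact_mod_cast this : (0 : ℂ) ≤ ((c - hT.eigenvalues i : ℝ) : ℂ))
  have hsub : c • 1 - T = φ (Matrix.diagonal fun i => ((c - hT.eigenvalues i : ℝ) : ℂ)) := by
    have h1 : (Matrix.diagonal fun i => ((c - hT.eigenvalues i : ℝ) : ℂ)) =
        (c : ℂ) • 1 - Matrix.diagonal (RCLike.ofReal ∘ hT.eigenvalues) := by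
      ext i k
      by_cases hik : i = k
      · subst hik
        simp
      · simp [hik]
    rw [h1, map_sub, map_smul, map_one, ← hs, Complex.coe_smul]
  rw [Matrix.le_iff, hsub, hφ, Unitary.conjStarAlgAut_apply]
  exact hdiag.mul_mul_conjTranspose_same _

/-- A convex combination of effects is, up to a small error, dominated by the average of few of
them. -/
theorem exists_average_le {w : ι → ℝ} (hw0 : ∀ i, 0 ≤ w i) (hw1 : ∑ i, w i = 1)
    {W : ι → Matrix n n ℂ} (hW0 : ∀ i, 0 ≤ W i) (hW1 : ∀ i, W i ≤ 1) {p K : ℕ} (hp : 0 < p)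
    (hK : 0 < K) {t : ℝ} (ht : 0 ≤ t)
    (h : (Fintype.card n : ℝ) * (4 * p ^ 2 * K) ^ p ≤ (t * K) ^ (2 * p)) :
    ∃ f : Fin K → ι, (K : ℝ)⁻¹ • ∑ k, W (f k) ≤ ∑ i, w i • W i + t • (1 : Matrix n n ℂ) := by
  set A := ∑ i, w i • W i with hA
  have hA0 : 0 ≤ A := Finset.sum_nonneg fun i _ => smul_nonneg (hw0 i) (hW0 i)
  have hA1 : A ≤ 1 := by
    have : A ≤ ∑ i, w i • (1 : Matrix n n ℂ) :=
      Finset.sum_le_sum fun i _ => smul_le_smul_of_nonneg_left (hW1 i) (hw0 i)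
    rwa [← Finset.sum_smul, hw1, one_smul] at this
  have hnorm : ∀ X : Matrix n n ℂ, 0 ≤ X → X ≤ 1 → ‖X‖ ≤ 1 := fun X h0 h1 =>
    (CStarAlgebra.norm_le_one_iff_of_nonneg X h0).2 h1
  have hY : ∀ i, ‖W i - A‖ ≤ 2 := fun i => by
    have := norm_sub_le (W i) A
    linarith [hnorm _ (hW0 i) (hW1 i), hnorm _ hA0 hA1]
  have h0 : ∑ i, w i • (W i - A) = 0 := by
    simp only [smul_sub, Finset.sum_sub_distrib, ← Finset.sum_smul, hw1, one_smul, ← hA, sub_self]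
  obtain ⟨f, hf⟩ := exists_trace_pow_le hw0 hw1 hY h0 hp K
  have hherm : (∑ k, (W (f k) - A)).IsHermitian := by
    refine isSelfAdjoint_sum _ fun k _ => ?_
    exact (hW0 (f k)).posSemidef.isHermitian.sub hA0.posSemidef.isHermitian
  have hT := le_smul_one_of_trace_pow_le hherm (by positivity) hp (hf.trans h)
  refine ⟨f, ?_⟩
  have hK' : (K : ℝ) ≠ 0 := by positivity
  have h1 := smul_le_smul_of_nonneg_left hT (inv_nonneg.2 (Nat.cast_nonneg (α := ℝ) K))
  rw [Finset.sum_sub_distrib, smul_sub, Finset.sum_const, Finset.card_univ, Fintype.card_fin,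
    ← Nat.cast_smul_eq_nsmul ℝ, smul_smul, smul_smul, inv_mul_cancel₀ hK', one_smul,
    mul_comm t, inv_mul_cancel_left₀ hK'] at h1
  rw [add_comm]
  exact sub_le_iff_le_add.1 h1

end Moments

/-! ### Means of random effects -/

section RandomOperators

open scoped Matrix.Norms.L2Operator
open MeasureTheory

variable {n Λ : Type*} [Fintype n] [DecidableEq n] [MeasurableSpace Λ] {P : Measure Λ}

theorem ofReal_trace_re {σ : State n} {X : Matrix n n ℂ} (hX : 0 ≤ X) :
    (((σ.1 * X).trace.re : ℝ) : ℂ) = (σ.1 * X).trace :=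
  Complex.ext rfl (by simpa using (Complex.le_def.1 (trace_mul_nonneg σ.2.1 hX.posSemidef)).2)

/-- Random codes are integrable only state by state. Pure states give integrability of every
quadratic form, and polarization gives that of every entry. -/
theorem integrable_of_forall_state {W : Λ → Matrix n n ℂ} (hW : ∀ t, 0 ≤ W t)
    (hint : ∀ σ : State n, Integrable (fun t => (σ.1 * W t).trace.re) P) : Integrable W P := by
  have hq : ∀ v : n → ℂ, Integrable (fun t => star v ⬝ᵥ W t *ᵥ v) P := by
    intro v
    by_cases hv : v = 0
    · simp [hv]
    obtain ⟨σ, hσ⟩ := exists_state_dotProduct_mulVec hv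
    simp only [hσ]
    refine Integrable.const_mul ?_ _
    exact ((hint σ).ofReal (𝕜 := ℂ)).congr
      (Filter.Eventually.of_forall fun t => ofReal_trace_re (hW t))
  have hentry : ∀ x y, Integrable (fun t => W t x y) P := by
    intro x y
    have h1 := hq (Pi.single x 1 + Pi.single y 1)
    have h2 := hq (Pi.single x 1 + Complex.I • Pi.single y 1)
    have h3 := hq (Pi.single x 1)
    have h4 := hq (Pi.single y 1)
    have h5 := ((h1.sub (h3.add h4)).sub ((h2.sub (h3.add h4)).const_mul Complex.I)).const_mul
      (1 / 2 : ℂ)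
    refine h5.congr (Filter.Eventually.of_forall fun t => ?_)
    simp only [Pi.sub_apply, Pi.add_apply, Matrix.mulVec_add, Matrix.mulVec_smul,
      Matrix.mulVec_single_one, star_add, star_smul, Pi.star_single, star_one, add_dotProduct,
      dotProduct_add, smul_dotProduct, dotProduct_smul, single_one_dotProduct, Matrix.col_apply,
      smul_eq_mul, Complex.star_def, Complex.conj_I]
    linear_combination (W t y x / 2 - W t x y / 2 + Complex.I * W t y y / 2) * Complex.I_sq
  have hsum : W = fun t => ∑ x, ∑ y, W t x y • Matrix.single x y (1 : ℂ) := by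
    funext t
    conv_lhs => rw [Matrix.matrix_eq_sum_single (W t)]
    simp
  rw [hsum]
  exact integrable_finsetSum _ fun x _ => integrable_finsetSum _ fun y _ =>
    (hentry x y).smul_const _

theorem trace_mul_integral {W : Λ → Matrix n n ℂ} (hW : ∀ t, 0 ≤ W t) (hint : Integrable W P)
    (σ : State n) :
    (σ.1 * ∫ t, W t ∂P).trace = ((∫ t, (σ.1 * W t).trace.re ∂P : ℝ) : ℂ) := by
  let f : Matrix n n ℂ →L[ℂ] ℂ := LinearMap.toContinuousLinearMap
    (Matrix.traceLinearMap n ℂ ℂ ∘ₗ LinearMap.mulLeft ℂ σ.1)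
  have h := f.integral_comp_comm hint
  have h1 : ∫ t, (((σ.1 * W t).trace.re : ℝ) : ℂ) ∂P =
      ((∫ t, (σ.1 * W t).trace.re ∂P : ℝ) : ℂ) := integral_ofReal
  rw [← h1, integral_congr_ae (Filter.Eventually.of_forall fun t => ofReal_trace_re (hW t))]
  exact h.symm

/-- If the mean of a random effect is at most `ε`, then so is, up to a small error, an average of few
of its values. -/
theorem exists_average_le_of_random [IsProbabilityMeasure P] {W : Λ → Matrix n n ℂ}
    (hW0 : ∀ t, 0 ≤ W t) (hW1 : ∀ t, W t ≤ 1)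
    (hint : ∀ σ : State n, Integrable (fun t => (σ.1 * W t).trace.re) P) {ε δ : ℝ} (hδ : 0 < δ)
    (hε : ∀ σ : State n, ∫ t, (σ.1 * W t).trace.re ∂P ≤ ε) {p K : ℕ} (hp : 0 < p)
    (hK : 0 < K) {t : ℝ} (ht : 0 ≤ t)
    (h : (Fintype.card n : ℝ) * (4 * p ^ 2 * K) ^ p ≤ (t * K) ^ (2 * p)) :
    ∃ f : Fin K → Λ, (K : ℝ)⁻¹ • ∑ k, W (f k) ≤ (ε + δ + t) • (1 : Matrix n n ℂ) := by
  have hi := integrable_of_forall_state hW0 hint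
  set A := ∫ t, W t ∂P with hA
  have hA0 : A.PosSemidef := posSemidef_of_forall_state fun σ => by
    rw [hA, trace_mul_integral hW0 hi σ]
    have : 0 ≤ ∫ t, (σ.1 * W t).trace.re ∂P := integral_nonneg fun t =>
      (Complex.le_def.1 (trace_mul_nonneg σ.2.1 (hW0 t).posSemidef)).1
    exact_mod_cast this
  have hA1 : A ≤ ε • (1 : Matrix n n ℂ) := le_smul_one_of_forall_state hA0 fun σ => by
    rw [hA, trace_mul_integral hW0 hi σ, Complex.ofReal_re]
    exact hε σ
  -- The mean lies in the closed convex hull of the values. Up to `δ` in norm it is a finite convex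
  -- combination of them, and sampling takes place from its weights instead of from `P`.
  have hmem : A ∈ closure (convexHull ℝ (Set.range W)) :=
    (convex_convexHull ℝ _).closure.integral_mem isClosed_closure
      (Filter.Eventually.of_forall fun t =>
        subset_closure (subset_convexHull ℝ _ (Set.mem_range_self t))) hi
  obtain ⟨X, hX, hAX⟩ := Metric.mem_closure_iff.1 hmem δ hδ
  obtain ⟨ι, _, w, z, hw0, hw1, hz, rfl⟩ := mem_convexHull_iff_exists_fintype.1 hX
  choose s hs using hz
  obtain ⟨f, hf⟩ := exists_average_le hw0 hw1 (fun i => hW0 (s i)) (fun i => hW1 (s i)) hp hK ht h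
  refine ⟨fun k => s (f k), hf.trans ?_⟩
  simp only [hs]
  have hX0 : (∑ i, w i • z i).PosSemidef :=
    (Finset.sum_nonneg fun i _ => smul_nonneg (hw0 i) (hs i ▸ hW0 (s i))).posSemidef
  have hXA : IsSelfAdjoint (∑ i, w i • z i - A) := hX0.isHermitian.sub hA0.isHermitian
  have h1 := hXA.le_algebraMap_norm_self
  rw [Algebra.algebraMap_eq_smul_one] at h1
  have h2 : ‖∑ i, w i • z i - A‖ • (1 : Matrix n n ℂ) ≤ δ • 1 := by
    refine smul_le_smul_of_nonneg_right ?_ PosSemidef.one.nonneg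
    rw [← dist_eq_norm, dist_comm]
    exact hAX.le
  have h3 : ∑ i, w i • z i ≤ δ • 1 + ε • (1 : Matrix n n ℂ) :=
    (sub_le_iff_le_add.1 (h1.trans h2)).trans (add_le_add le_rfl hA1)
  rw [add_smul, add_smul, add_comm (ε • (1 : Matrix n n ℂ))]
  exact add_le_add h3 le_rfl

end RandomOperators

/-! ### Vanishing errors, rates and interpolation between block lengths -/

section Limits

open scoped Topology
open MeasureTheory Filter

/-- Nonemptiness of `j` provides a jammer state at every length, so the supremum is at least `0`; an
empty supremum in `EReal` would be `⊥`. -/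
theorem errorVanishes_iff {j : Type*} [Fintype j] [Nonempty j]
    {err : ∀ ℓ : ℕ, State (Fin ℓ → j) → ℝ} (h0 : ∀ ℓ σ, 0 ≤ err ℓ σ) :
    ErrorVanishes err ↔ ∀ δ > 0, ∀ᶠ ℓ in atTop, ∀ σ, err ℓ σ ≤ δ := by
  constructor
  · intro h δ hδ
    have hδ' : (0 : EReal) < (δ : EReal) := by exact_mod_cast hδ
    filter_upwards [h.eventually (gt_mem_nhds hδ')] with ℓ hℓ σ
    have := (le_iSup (fun σ => (err ℓ σ : EReal)) σ).trans hℓ.le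
    exact_mod_cast this
  · intro h
    refine tendsto_order.2 ⟨fun c hc => Eventually.of_forall fun ℓ => hc.trans_le ?_,
      fun c hc => ?_⟩
    · have σ : State (Fin ℓ → j) := Classical.arbitrary _
      have h1 : (0 : EReal) ≤ (err ℓ σ : EReal) := by exact_mod_cast h0 ℓ σ
      exact h1.trans (le_iSup (fun σ => (err ℓ σ : EReal)) σ)
    · obtain ⟨δ, hδ0, hδ⟩ := EReal.lt_iff_exists_real_btwn.1 hc
      filter_upwards [h δ (by exact_mod_cast hδ0)] with ℓ hℓ
      refine lt_of_le_of_lt (iSup_le fun σ => ?_) hδ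
      exact_mod_cast hℓ σ

theorem logb_natCast_nonneg (K : ℕ) : 0 ≤ Real.logb 2 K := by
  rcases Nat.eq_zero_or_pos K with rfl | h
  · simp
  · exact Real.logb_nonneg one_lt_two (by exact_mod_cast h)

theorem asympRate_nonneg (K : ℕ → ℕ) : 0 ≤ asympRate K := by
  refine le_limsup_of_frequently_le' (Eventually.of_forall fun ℓ => ?_).frequently
  have : 0 ≤ Real.logb 2 (K ℓ) / ℓ := div_nonneg (logb_natCast_nonneg _) (Nat.cast_nonneg _)
  exact_mod_cast this

/-- Along the lengths `s n + n` the rate is multiplied by `1 / (s n / n + 1)`, which tends to `1`.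
Other lengths can only raise the limsup. -/
theorem asympRate_le_of_shift {s M M' : ℕ → ℕ}
    (hlim : Tendsto (fun n => (s n : ℝ) / n) atTop (𝓝 0))
    (hM : ∀ᶠ n in atTop, M' (s n + n) = M n) : asympRate M ≤ asympRate M' := by
  have hφ : Tendsto (fun n => s n + n) atTop atTop :=
    tendsto_atTop_mono (fun n => Nat.le_add_left n (s n)) tendsto_id
  have h1 : limsup (fun n => ((Real.logb 2 (M' (s n + n)) / ((s n + n : ℕ) : ℝ) : ℝ) : EReal))
      atTop ≤ asympRate M' := limsup_le_limsup_of_le (u := fun ℓ : ℕ =>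
        ((Real.logb 2 (M' ℓ) / ℓ : ℝ) : EReal)) hφ
  refine le_trans ?_ h1
  refine le_of_forall_lt fun c hc => ?_
  obtain ⟨c', hcc', hc'⟩ := EReal.lt_iff_exists_real_btwn.1 hc
  obtain ⟨r, hr', hr⟩ := EReal.lt_iff_exists_real_btwn.1 hc'
  have hr' : c' < r := by exact_mod_cast hr'
  refine hcc'.trans_le (le_limsup_of_frequently_le' ?_)
  have h2 : Tendsto (fun n => r * (1 / ((s n : ℝ) / n + 1))) atTop (𝓝 r) := by
    have := (hlim.add_const 1).inv₀ (by norm_num)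
    simpa using this.const_mul r
  refine ((frequently_lt_of_lt_limsup (by isBoundedDefault) hr).and_eventually
    ((h2.eventually (lt_mem_nhds hr')).and (hM.and (eventually_gt_atTop 0)))).mono ?_
  rintro n ⟨hn1, hn2, hn3, hn4⟩
  have hn : (0 : ℝ) < n := by exact_mod_cast hn4
  rw [hn3]
  have hn1 : r < Real.logb 2 (M n) / n := by exact_mod_cast hn1
  have h3 : Real.logb 2 (M n) / ((s n + n : ℕ) : ℝ) =
      Real.logb 2 (M n) / n * (1 / ((s n : ℝ) / n + 1)) := by
    push_cast
    field_simp
  have h4 : c' ≤ Real.logb 2 (M n) / ((s n + n : ℕ) : ℝ) := by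
    rw [h3]
    exact hn2.le.trans (mul_le_mul_of_nonneg_right hn1.le (by positivity))
  exact_mod_cast h4

/-- Objects of size `M n` at the lengths `s n + n`, with `s n = o(n)`, extend to a sequence of objects
at all lengths without loss of rate. -/
theorem exists_sequence {G : ℕ → ℕ → ℝ → Prop} (htriv : ∀ ℓ, G ℓ 1 0) {s : ℕ → ℕ}
    (hs : Monotone s) (hlim : Tendsto (fun n => (s n : ℝ) / n) atTop (𝓝 0)) {M : ℕ → ℕ}
    {e : ℕ → ℝ} (he : Tendsto e atTop (𝓝 0))
    (hG : ∀ᶠ n in atTop, G (s n + n) (M n) (e n)) :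
    ∃ (M' : ℕ → ℕ) (e' : ℕ → ℝ), (∀ ℓ, G ℓ (M' ℓ) (e' ℓ)) ∧ Tendsto e' atTop (𝓝 0) ∧
      asympRate M ≤ asympRate M' := by
  obtain ⟨n₀, hn₀⟩ := eventually_atTop.1 hG
  -- Strict monotonicity makes a length determine `n`, so the choice of object at that length is
  -- unambiguous. Lengths not of this form get the trivial object.
  have hmono : StrictMono fun n => s n + n := hs.add_strictMono strictMono_id
  have key : ∀ ℓ, ∃ (m : ℕ) (x : ℝ), G ℓ m x ∧
      (∀ n, n₀ ≤ n → s n + n = ℓ → m = M n ∧ x = e n) ∧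
      ((¬ ∃ n, n₀ ≤ n ∧ s n + n = ℓ) → x = 0) := by
    intro ℓ
    by_cases h : ∃ n, n₀ ≤ n ∧ s n + n = ℓ
    · obtain ⟨n, hn, rfl⟩ := h
      refine ⟨M n, e n, hn₀ n hn, fun n' _ h' => ?_, fun h' => (h' ⟨n, hn, rfl⟩).elim⟩
      rw [hmono.injective h']
      exact ⟨rfl, rfl⟩
    · exact ⟨1, 0, htriv ℓ, fun n hn hnℓ => (h ⟨n, hn, hnℓ⟩).elim, fun _ => rfl⟩
  choose M' e' h1 h2 h3 using key
  refine ⟨M', e', h1, ?_, asympRate_le_of_shift hlim ?_⟩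
  · rw [Metric.tendsto_atTop] at he ⊢
    intro δ hδ
    obtain ⟨n₁, hn₁⟩ := he δ hδ
    refine ⟨s n₁ + n₁, fun ℓ hℓ => ?_⟩
    by_cases h : ∃ n, n₀ ≤ n ∧ s n + n = ℓ
    · obtain ⟨n, hn, rfl⟩ := h
      rw [(h2 _ n hn rfl).2]
      exact hn₁ n (hmono.le_iff_le.1 hℓ)
    · rw [h3 ℓ h, dist_self]
      exact hδ
  · filter_upwards [eventually_ge_atTop n₀] with n hn
    exact (h2 _ n hn rfl).1

end Limits

/-! ### The number of index bits and its growth -/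

section Parameters

open scoped Topology
open MeasureTheory Filter

/-- The number of bits of the index that is sent ahead of a code of block length `n`. -/
def indexBits (n : ℕ) : ℕ := 2 ^ (Nat.log 2 (Nat.log 2 n) + 3)

/-- The exponent is at least `2 * (Nat.log 2 n + 1)`. Rounding the logarithm to a power of two lets
`indexBits n` serve as the `2 ^ r` of `HasTest.amplify`. -/
theorem sq_le_two_pow_log (n : ℕ) : n ^ 2 ≤ 2 ^ 2 ^ (Nat.log 2 (Nat.log 2 n) + 2) := by
  have h1 : Nat.log 2 n + 1 ≤ 2 ^ (Nat.log 2 (Nat.log 2 n) + 1) :=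
    Nat.lt_pow_succ_log_self one_lt_two _
  have h2 : n ≤ 2 ^ (Nat.log 2 n + 1) := (Nat.lt_pow_succ_log_self one_lt_two _).le
  calc n ^ 2 ≤ (2 ^ (Nat.log 2 n + 1)) ^ 2 := Nat.pow_le_pow_left h2 2
    _ = 2 ^ ((Nat.log 2 n + 1) * 2) := by rw [pow_mul]
    _ ≤ 2 ^ 2 ^ (Nat.log 2 (Nat.log 2 n) + 2) := by
      refine Nat.pow_le_pow_right two_pos ?_
      rw [pow_succ 2 (Nat.log 2 (Nat.log 2 n) + 1)]
      omega

theorem pow_four_le_two_pow_indexBits (n : ℕ) : n ^ 4 ≤ 2 ^ indexBits n := by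
  have h := Nat.pow_le_pow_left (sq_le_two_pow_log n) 2
  rw [← pow_mul, ← pow_mul, ← pow_succ] at h
  exact h

theorem indexBits_mul_half_pow_le {n : ℕ} (hn : 0 < n) :
    (indexBits n : ℝ) * (1 / 2) ^ indexBits n ≤ 2 / n := by
  set y := 2 ^ (Nat.log 2 (Nat.log 2 n) + 2) with hy
  have h1 : indexBits n = y * 2 := by rw [indexBits, hy, ← pow_succ]
  have hn' : (0 : ℝ) < n := by exact_mod_cast hn
  have h2 : (y : ℝ) ≤ 2 ^ y := by exact_mod_cast Nat.lt_two_pow_self.le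
  have h3 : (n : ℝ) ^ 2 ≤ 2 ^ y := by exact_mod_cast sq_le_two_pow_log n
  have h4 : (n : ℝ) ≤ 2 ^ y := by
    refine le_trans ?_ h3
    have : (1 : ℝ) ≤ n := by exact_mod_cast hn
    nlinarith
  have h5 : (0 : ℝ) < 2 ^ y := by positivity
  rw [h1, pow_mul, one_div, inv_pow, Nat.cast_mul, Nat.cast_ofNat, inv_pow, ← div_eq_mul_inv,
    div_le_div_iff₀ (by positivity) hn']
  nlinarith [mul_le_mul h2 h4 hn'.le h5.le]

theorem monotone_indexBits : Monotone indexBits := fun _ _ h =>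
  Nat.pow_le_pow_right two_pos
    (Nat.add_le_add_right (Nat.log_mono_right (Nat.log_mono_right h)) 3)

theorem tendsto_indexBits_pow_div (c : ℕ) :
    Tendsto (fun n => ((indexBits n ^ 3 * c : ℕ) : ℝ) / n) atTop (𝓝 0) := by
  have hlog : Tendsto (Nat.log 2) atTop atTop :=
    tendsto_atTop_atTop.2 fun b => ⟨2 ^ b, fun n hn => Nat.le_log_of_pow_le one_lt_two hn⟩
  -- With `k = Nat.log 2 n`, the bound `indexBits n ≤ 8 * (k + 1)` gives `512 = 8 ^ 3`; the factor
  -- `2` turns `2 ^ k` into `2 ^ (k + 1)`.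
  have h1 : Tendsto (fun k : ℕ => (512 * c * 2 : ℝ) * (((k + 1 : ℕ) : ℝ) ^ 3 / 2 ^ (k + 1)))
      atTop (𝓝 0) := by
    have := ((tendsto_pow_const_div_const_pow_of_one_lt 3 (one_lt_two (α := ℝ))).comp
      (tendsto_add_atTop_nat 1)).const_mul (512 * c * 2 : ℝ)
    simpa using this
  refine squeeze_zero' (Eventually.of_forall fun n => by positivity) ?_ (h1.comp hlog)
  filter_upwards [eventually_gt_atTop 0] with n hn
  set k := Nat.log 2 n with hk
  have h2 : 2 ^ Nat.log 2 k ≤ k + 1 := by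
    rcases Nat.eq_zero_or_pos k with h0 | h0
    · simp [h0]
    · exact (Nat.pow_log_le_self 2 h0.ne').trans (Nat.le_succ k)
  have h3 : (2 : ℝ) ^ k ≤ n := by exact_mod_cast Nat.pow_log_le_self 2 hn.ne'
  have h4 : (indexBits n : ℝ) ≤ 8 * ((k + 1 : ℕ) : ℝ) := by
    have : indexBits n ≤ 8 * (k + 1) := by
      rw [indexBits, ← hk, pow_add]
      omega
    exact_mod_cast this
  have h5 : (indexBits n : ℝ) ^ 3 ≤ (8 * ((k + 1 : ℕ) : ℝ)) ^ 3 :=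
    pow_le_pow_left₀ (by positivity) h4 3
  calc ((indexBits n ^ 3 * c : ℕ) : ℝ) / n ≤ ((8 * ((k + 1 : ℕ) : ℝ)) ^ 3 * c) / 2 ^ k := by
        push_cast at h5 ⊢
        gcongr
    _ = _ := by
        simp only [Function.comp, ← hk]
        rw [pow_succ 2 k]
        field_simp
        ring

end Parameters

/-! ### Derandomization -/

section Derandomization

open scoped Topology
open MeasureTheory Filter

variable {a j b : Type*} [Fintype a] [DecidableEq a] [Fintype j] [DecidableEq j] [Fintype b]
  [DecidableEq b] {N : SuperOp (a × j) b}

theorem exists_hasTest [Nonempty j] (hN : IsCPTP N) (h : 0 < Cdet N) :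
    ∃ ℓ, HasTest N ℓ (1 / 8) (1 / 8) := by
  obtain ⟨R, ⟨M, C, hC, rfl⟩, hR⟩ := lt_sSup_iff.1 h
  have h0 : ∀ ℓ σ, 0 ≤ (C ℓ).err N σ := fun ℓ σ => by
    rw [ClassicalCode.err_eq]
    exact (Complex.le_def.1
      (trace_mul_nonneg σ.2.1 ((C ℓ).errOp_nonneg hN).posSemidef)).1
  -- Passing to a test triples the error, and `3 * (1 / 24) = 1 / 8`.
  have h1 := (errorVanishes_iff h0).1 hC (1 / 24) (by norm_num)
  obtain ⟨ℓ, hℓ, hℓ'⟩ :=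
    ((frequently_lt_of_lt_limsup (by isBoundedDefault) hR).and_eventually h1).exists
  have hℓ : 0 < Real.logb 2 (M ℓ) / ℓ := by exact_mod_cast hℓ
  have hM : 2 ≤ M ℓ := by
    by_contra! hM
    -- Both sizes have `logb` equal to `0`, the first by the default value at `0`.
    have : M ℓ = 0 ∨ M ℓ = 1 := by omega
    rcases this with h | h <;> simp [h] at hℓ
  refine ⟨ℓ, ?_⟩
  have h2 : (C ℓ).errOp N ≤ (1 / 24 : ℝ) • (1 : Matrix (Fin ℓ → j) (Fin ℓ → j) ℂ) :=
    le_smul_one_of_forall_state ((C ℓ).errOp_nonneg hN).posSemidef fun σ => by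
      rw [← ClassicalCode.err_eq]
      exact hℓ' σ
  have := (C ℓ).hasTest hN hM (by norm_num) h2
  norm_num at this ⊢
  exact this

/-- With `k = indexBits n = 2 ^ r`, amplification gives one bit at length `4 ^ r * ℓ = k ^ 2 * ℓ`
with error `(1 / 2) ^ k / 4`. Using it `k` times sends `k` bits at length `k ^ 3 * ℓ`. -/
theorem HasTest.hasCode_indexBits [Nonempty a] (hN : IsCPTP N) {ℓ : ℕ}
    (h : HasTest N ℓ (1 / 8) (1 / 8)) {n : ℕ} (hn : 0 < n) :
    ∃ e : ℝ, 0 ≤ e ∧ e ≤ 2 / n ∧ HasCode N (indexBits n ^ 3 * ℓ) (2 ^ indexBits n) e := by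
  have h1 := ((h.amplify hN (by norm_num) (Nat.log 2 (Nat.log 2 n) + 3)).hasCode.pow hN
    (indexBits n))
  have h2 : indexBits n * (4 ^ (Nat.log 2 (Nat.log 2 n) + 3) * ℓ) = indexBits n ^ 3 * ℓ := by
    rw [show (4 : ℕ) = 2 ^ 2 from rfl, ← pow_mul, mul_comm 2, pow_mul]
    change indexBits n * (indexBits n ^ 2 * ℓ) = _
    ring
  rw [h2] at h1
  refine ⟨_, by positivity, ?_, h1⟩
  have h3 := indexBits_mul_half_pow_le hn
  have h4 : (0 : ℝ) ≤ (indexBits n : ℝ) * (1 / 2) ^ indexBits n := by positivity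
  calc (indexBits n : ℝ) * ((4 * (1 / 8)) ^ 2 ^ (Nat.log 2 (Nat.log 2 n) + 3) / 4) =
        (indexBits n : ℝ) * (1 / 2) ^ indexBits n / 4 := by
        rw [indexBits]
        norm_num
        ring
    _ ≤ 2 / n := by linarith

/-- Taking the moment order equal to `n` makes the dimension `d ^ n` contribute only a factor `d`
after the `n`-th root. What remains is `4 * d * n ^ 2 * K ≤ 4 * d * K ^ 2 / n ^ 2`, which follows
from `n ^ 4 ≤ K`. -/
theorem moment_condition {d n K : ℕ} (hn : 0 < n) (hK : n ^ 4 ≤ K) :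
    ((d ^ n : ℕ) : ℝ) * (4 * n ^ 2 * K) ^ n ≤ (2 * √d / n * K) ^ (2 * n) := by
  have hn' : (0 : ℝ) < n := by exact_mod_cast hn
  have hK' : (n : ℝ) ^ 4 ≤ K := by exact_mod_cast hK
  rw [pow_mul, Nat.cast_pow, ← mul_pow]
  refine pow_le_pow_left₀ (by positivity) ?_ n
  rw [mul_pow, div_pow, mul_pow, Real.sq_sqrt (by positivity), div_mul_eq_mul_div,
    le_div_iff₀ (by positivity)]
  have h1 : 0 ≤ 4 * (d : ℝ) * K * (K - n ^ 4) :=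
    mul_nonneg (by positivity) (sub_nonneg.2 hK')
  nlinarith

/-- Derandomization: in the presence of a good test, a random family of error operators can be
replaced by one error operator of a slightly longer code. -/
theorem exists_errOp_le_of_random [Nonempty a] (hN : IsCPTP N) {ℓ : ℕ}
    (htest : HasTest N ℓ (1 / 8) (1 / 8))
    {S : ∀ ℓ _M : ℕ, Set (Matrix (Fin ℓ → j) (Fin ℓ → j) ℂ)}
    (h0 : ∀ ℓ M, ∀ X ∈ S ℓ M, 0 ≤ X) (h1 : ∀ ℓ M, ∀ X ∈ S ℓ M, X ≤ 1)
    (hconcat : ∀ {m n K M : ℕ} {e : ℝ}, 0 < K → 0 ≤ e → HasCode N m K e →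
      ∀ V : Fin K → Matrix (Fin n → j) (Fin n → j) ℂ, (∀ k, V k ∈ S n M) →
      ∃ X ∈ S (m + n) M, X ≤ e • 1 + cat 1 ((K : ℝ)⁻¹ • ∑ k, V k))
    {n M : ℕ} (hn : 0 < n) {Λ : Type} [MeasurableSpace Λ] {P : Measure Λ}
    [IsProbabilityMeasure P] {W : Λ → Matrix (Fin n → j) (Fin n → j) ℂ} (hW : ∀ t, W t ∈ S n M)
    (hint : ∀ σ : State (Fin n → j), Integrable (fun t => (σ.1 * W t).trace.re) P) {ε : ℝ}
    (hε : ∀ σ : State (Fin n → j), ∫ t, (σ.1 * W t).trace.re ∂P ≤ ε) :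
    ∃ X ∈ S (indexBits n ^ 3 * ℓ + n) M,
      X ≤ (ε + (3 + 2 * √(Fintype.card j)) / n) •
        (1 : Matrix (Fin (indexBits n ^ 3 * ℓ + n) → j) (Fin (indexBits n ^ 3 * ℓ + n) → j) ℂ) := by
  have hn' : (0 : ℝ) < n := by exact_mod_cast hn
  have hK : 0 < 2 ^ indexBits n := by positivity
  obtain ⟨e, he0, he1, hcode⟩ := htest.hasCode_indexBits hN hn
  obtain ⟨f, hf⟩ := exists_average_le_of_random (fun t => h0 _ _ _ (hW t))
    (fun t => h1 _ _ _ (hW t)) hint (show (0 : ℝ) < 1 / n by positivity) hε hn hK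
    (t := 2 * √(Fintype.card j) / n) (by positivity)
    (by simpa using moment_condition (d := Fintype.card j) hn (pow_four_le_two_pow_indexBits n))
  obtain ⟨X, hX, hXle⟩ := hconcat hK he0 hcode (fun k => W (f k)) fun k => hW _
  refine ⟨X, hX, hXle.trans ?_⟩
  have hpos : 0 ≤ ((2 ^ indexBits n : ℕ) : ℝ)⁻¹ • ∑ k, W (f k) :=
    smul_nonneg (by positivity) (Finset.sum_nonneg fun k _ => h0 _ _ _ (hW _))
  have h2 := cat_mono (m := indexBits n ^ 3 * ℓ) (le_refl 1) hf PosSemidef.one.nonneg hpos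
  rw [cat_one_smul_one] at h2
  refine (add_le_add le_rfl h2).trans ?_
  rw [← add_smul]
  refine smul_le_smul_of_nonneg_right ?_ PosSemidef.one.nonneg
  -- The three terms come from the prefix code, the convex approximation of the mean, and the
  -- sampling.
  have : (3 + 2 * √(Fintype.card j)) / (n : ℝ) = 2 / n + 1 / n + 2 * √(Fintype.card j) / n := by
    ring
  linarith

/-- `S ℓ M` stands for the error operators of the codes of length `ℓ` and size `M`. The argument
needs only that they are effects, that a trivial code exists, and that an index can be prefixed, so
it serves classical and quantum codes alike. -/
theorem exists_deterministic [Nonempty a] [Nonempty j] (hN : IsCPTP N) (hC : 0 < Cdet N)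
    {S : ∀ ℓ _M : ℕ, Set (Matrix (Fin ℓ → j) (Fin ℓ → j) ℂ)}
    (h0 : ∀ ℓ M, ∀ X ∈ S ℓ M, 0 ≤ X) (h1 : ∀ ℓ M, ∀ X ∈ S ℓ M, X ≤ 1)
    (htriv : ∀ ℓ, 0 ∈ S ℓ 1)
    (hconcat : ∀ {m n K M : ℕ} {e : ℝ}, 0 < K → 0 ≤ e → HasCode N m K e →
      ∀ V : Fin K → Matrix (Fin n → j) (Fin n → j) ℂ, (∀ k, V k ∈ S n M) →
      ∃ X ∈ S (m + n) M, X ≤ e • 1 + cat 1 ((K : ℝ)⁻¹ • ∑ k, V k))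
    {M : ℕ → ℕ} {err : ∀ n, State (Fin n → j) → ℝ} (herr : ErrorVanishes err)
    (hrand : ∀ n, ∃ (Λ : Type) (_ : MeasurableSpace Λ) (P : Measure Λ) (_ : IsProbabilityMeasure P)
      (W : Λ → Matrix (Fin n → j) (Fin n → j) ℂ), (∀ t, W t ∈ S n (M n)) ∧
      (∀ σ : State (Fin n → j), Integrable (fun t => (σ.1 * W t).trace.re) P) ∧
      ∀ σ : State (Fin n → j), ∫ t, (σ.1 * W t).trace.re ∂P = err n σ) :
    ∃ (M' : ℕ → ℕ) (X : ∀ ℓ, Matrix (Fin ℓ → j) (Fin ℓ → j) ℂ), (∀ ℓ, X ℓ ∈ S ℓ (M' ℓ)) ∧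
      ErrorVanishes (fun ℓ σ => (σ.1 * X ℓ).trace.re) ∧ asympRate M ≤ asympRate M' := by
  obtain ⟨ℓ₀, htest⟩ := exists_hasTest hN hC
  have hnn : ∀ {ℓ : ℕ} (σ : State (Fin ℓ → j)) {X : Matrix (Fin ℓ → j) (Fin ℓ → j) ℂ}, 0 ≤ X →
      0 ≤ (σ.1 * X).trace.re := fun σ X hX =>
    (Complex.le_def.1 (trace_mul_nonneg σ.2.1 hX.posSemidef)).1
  have herr01 : ∀ n σ, 0 ≤ err n σ ∧ err n σ ≤ 1 := by
    intro n σ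
    obtain ⟨Λ, _, P, _, W, hW, hint, heq⟩ := hrand n
    rw [← heq σ]
    refine ⟨integral_nonneg fun t => hnn σ (h0 _ _ _ (hW t)), ?_⟩
    have h2 : ∀ t, (σ.1 * W t).trace.re ≤ 1 := fun t =>
      trace_state_mul_le (by simpa using h1 _ _ _ (hW t)) σ
    simpa using integral_mono (hint σ) (integrable_const (1 : ℝ)) h2
  -- Boundedness makes the real supremum used below an upper bound, not the default value `0`.
  have hbdd : ∀ n, BddAbove (Set.range (err n)) := fun n => ⟨1, by
    rintro _ ⟨σ, rfl⟩
    exact (herr01 n σ).2⟩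
  have hε : Tendsto (fun n => ⨆ σ, err n σ) atTop (𝓝 0) := by
    refine tendsto_order.2 ⟨fun c hc => Eventually.of_forall fun n => hc.trans_le ?_,
      fun c hc => ?_⟩
    · exact Real.iSup_nonneg fun σ => (herr01 n σ).1
    · filter_upwards [(errorVanishes_iff fun n σ => (herr01 n σ).1).1 herr (c / 2) (by positivity)]
        with n hn
      exact (ciSup_le hn).trans_lt (by linarith)
  have hη : Tendsto (fun n : ℕ => (⨆ σ, err n σ) + (3 + 2 * √(Fintype.card j)) / (n : ℝ)) atTop
      (𝓝 0) := by
    simpa using hε.add (tendsto_const_div_atTop_nhds_zero_nat (3 + 2 * √(Fintype.card j)))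
  obtain ⟨M', e', hG, he', hrate⟩ := exists_sequence
    (G := fun ℓ M e => ∃ X ∈ S ℓ M, X ≤ e • (1 : Matrix (Fin ℓ → j) (Fin ℓ → j) ℂ))
    (fun ℓ => ⟨0, htriv ℓ, by simp⟩) (s := fun n => indexBits n ^ 3 * ℓ₀)
    (fun n n' h => Nat.mul_le_mul_right _ (Nat.pow_le_pow_left (monotone_indexBits h) 3))
    (tendsto_indexBits_pow_div ℓ₀) (M := M) hη (by
      filter_upwards [eventually_gt_atTop 0] with n hn
      obtain ⟨Λ, _, P, _, W, hW, hint, heq⟩ := hrand n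
      exact exists_errOp_le_of_random hN htest h0 h1 hconcat hn hW hint fun σ => by
        rw [heq σ]
        exact le_ciSup (hbdd n) σ)
  choose X hX hXle using hG
  refine ⟨M', X, hX, (errorVanishes_iff fun ℓ σ => hnn σ (h0 _ _ _ (hX ℓ))).2 fun δ hδ => ?_,
    hrate⟩
  filter_upwards [he'.eventually (gt_mem_nhds hδ)] with ℓ hℓ σ
  exact (trace_state_mul_le (hXle ℓ) σ).trans hℓ.le

end Derandomization

/-! ### Comparison of the capacities -/

section Capacities

open scoped Topology
open MeasureTheory Filter

variable {a j b : Type*} [Fintype a] [DecidableEq a] [Fintype j] [DecidableEq j] [Fintype b]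
  [DecidableEq b] {N : SuperOp (a × j) b}

theorem integrable_dirac_unit (f : Unit → ℝ) : Integrable f (Measure.dirac ()) :=
  integrable_dirac (by simp)

theorem Cdet_le_Crand (N : SuperOp (a × j) b) : Cdet N ≤ Crand N := by
  refine sSup_le_sSup ?_
  rintro R ⟨M, C, hC, rfl⟩
  refine ⟨M, fun ℓ => ⟨Unit, inferInstance, Measure.dirac (), inferInstance, fun _ => C ℓ,
    fun σ => integrable_dirac_unit _⟩, ?_, rfl⟩
  simpa [RandomClassicalCode.err] using hC

theorem Qdet_le_Qrand (N : SuperOp (a × j) b) : Qdet N ≤ Qrand N := by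
  refine sSup_le_sSup ?_
  rintro R ⟨L, Q, hQ, rfl⟩
  refine ⟨L, fun ℓ => ⟨Unit, inferInstance, Measure.dirac (), inferInstance, fun _ => Q ℓ,
    fun σ => integrable_dirac_unit _⟩, ?_, rfl⟩
  simpa [RandomQuantumCode.infid] using hQ

theorem Crand_le_Cdet [Nonempty a] [Nonempty j] (hN : IsCPTP N) (h : 0 < Cdet N) :
    Crand N ≤ Cdet N := by
  refine sSup_le ?_
  rintro R ⟨M, C, hC, rfl⟩
  obtain ⟨M', X, hX, hX0, hrate⟩ := exists_deterministic hN h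
    (S := fun ℓ M => Set.range fun C : ClassicalCode a b ℓ M => C.errOp N)
    (by rintro ℓ M _ ⟨C, rfl⟩; exact C.errOp_nonneg hN)
    (by rintro ℓ M _ ⟨C, rfl⟩; exact C.errOp_le_one hN)
    (fun ℓ => by
      refine ⟨⟨fun _ => Classical.arbitrary _, fun _ => 1, fun _ => PosSemidef.one, by simp⟩, ?_⟩
      simp [ClassicalCode.errOp])
    (by
      intro m n K M e hK he hcode V hV
      choose C' hC' using hV
      obtain ⟨C'', h⟩ := ClassicalCode.exists_concat hN hK he hcode C'
      exact ⟨_, ⟨C'', rfl⟩, by simpa only [hC'] using h⟩) hC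
    (fun n => ⟨(C n).Λ, (C n).mΛ, (C n).P, (C n).isProb, fun t => ((C n).code t).errOp N,
      fun t => ⟨_, rfl⟩, fun σ => by
        simpa only [ClassicalCode.err_eq] using (C n).integrable σ, fun σ => by
        simp only [RandomClassicalCode.err, ClassicalCode.err_eq]⟩)
  choose C' hC' using hX
  refine hrate.trans (le_sSup ⟨M', C', ?_, rfl⟩)
  simpa only [ClassicalCode.err_eq, hC'] using hX0

theorem Qrand_le_Qdet [Nonempty a] [Nonempty j] (hN : IsCPTP N) (h : 0 < Cdet N) :
    Qrand N ≤ Qdet N := by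
  refine sSup_le ?_
  rintro R ⟨L, Q, hQ, rfl⟩
  obtain ⟨L', X, hX, hX0, hrate⟩ := exists_deterministic hN h
    (S := fun ℓ L => Set.range fun Q : QuantumCode a b ℓ L => Q.infidOp N)
    (by rintro ℓ L _ ⟨Q, rfl⟩; exact Q.infidOp_nonneg hN)
    (by rintro ℓ L _ ⟨Q, rfl⟩; exact Q.infidOp_le_one hN)
    (fun ℓ => ⟨QuantumCode.trivial (Classical.arbitrary _), QuantumCode.infidOp_trivial hN _⟩)
    (by
      intro m n K L e hK he hcode V hV
      choose Q' hQ' using hV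
      obtain ⟨Q'', h⟩ := QuantumCode.exists_concat hN hK he hcode Q'
      exact ⟨_, ⟨Q'', rfl⟩, by simpa only [hQ'] using h⟩) hQ
    (fun n => ⟨(Q n).Λ, (Q n).mΛ, (Q n).P, (Q n).isProb, fun t => ((Q n).code t).infidOp N,
      fun t => ⟨_, rfl⟩, fun σ => by
        simpa only [QuantumCode.infid_eq] using (Q n).integrable σ, fun σ => by
        simp only [RandomQuantumCode.infid, QuantumCode.infid_eq]⟩)
  choose Q' hQ' using hX
  refine hrate.trans (le_sSup ⟨L', Q', ?_, rfl⟩)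
  simpa only [QuantumCode.infid_eq, hQ'] using hX0

theorem Cdet_nonneg [Nonempty a] [Nonempty j] (N : SuperOp (a × j) b) : 0 ≤ Cdet N := by
  refine (asympRate_nonneg fun _ => 1).trans (le_sSup ⟨fun _ => 1, fun ℓ => ⟨fun _ =>
    Classical.arbitrary _, fun _ => 1, fun _ => PosSemidef.one, by simp⟩, ?_, rfl⟩)
  rw [errorVanishes_iff]
  · intro δ hδ
    exact Eventually.of_forall fun ℓ σ => by simpa [ClassicalCode.err] using hδ.le
  · simp [ClassicalCode.err]

theorem Qdet_nonneg [Nonempty a] [Nonempty j] (hN : IsCPTP N) : 0 ≤ Qdet N := by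
  refine (asympRate_nonneg fun _ => 1).trans (le_sSup ⟨fun _ => 1, fun ℓ =>
    QuantumCode.trivial (Classical.arbitrary _), ?_, rfl⟩)
  simp only [QuantumCode.infid_eq, QuantumCode.infidOp_trivial hN]
  rw [errorVanishes_iff]
  · intro δ hδ
    exact Eventually.of_forall fun ℓ σ => by simpa using hδ.le
  · simp

/-- Sending basis states through a quantum code gives a classical code of the same size, with error
at most the infidelity (`QuantumCode.errOp_toClassical_le`). -/
theorem Qdet_le_Cdet [Nonempty j] (hN : IsCPTP N) : Qdet N ≤ Cdet N := by
  refine sSup_le_sSup ?_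
  rintro R ⟨L, Q, hQ, rfl⟩
  have h1 : ∀ ℓ σ, 0 ≤ (Q ℓ).toClassical.err N σ := fun ℓ σ => by
    rw [ClassicalCode.err_eq]
    exact (Complex.le_def.1
      (trace_mul_nonneg σ.2.1 ((Q ℓ).toClassical.errOp_nonneg hN).posSemidef)).1
  have h2 : ∀ ℓ σ, (Q ℓ).toClassical.err N σ ≤ (Q ℓ).infid N σ := fun ℓ σ => by
    rw [ClassicalCode.err_eq, QuantumCode.infid_eq]
    exact trace_mul_mono σ.2.1 ((Q ℓ).errOp_toClassical_le hN)
  refine ⟨L, fun ℓ => (Q ℓ).toClassical, (errorVanishes_iff h1).2 fun δ hδ => ?_, rfl⟩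
  filter_upwards [(errorVanishes_iff fun ℓ σ => (h1 ℓ σ).trans (h2 ℓ σ)).1 hQ δ hδ] with ℓ hℓ σ
  exact (h2 ℓ σ).trans (hℓ σ)

end Capacities

end QAVC

end

theorem corollary5 {a j b : Type*} [Fintype a] [DecidableEq a] [Nonempty a]
    [Fintype j] [DecidableEq j] [Nonempty j] [Fintype b] [DecidableEq b]
    (N : QAVC.SuperOp (a × j) b) (hN : QAVC.IsCPTP N) :
    QAVC.Cdet N = (if 0 < QAVC.Cdet N then QAVC.Crand N else 0) ∧
      QAVC.Qdet N = (if 0 < QAVC.Cdet N then QAVC.Qrand N else 0) := by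
  split_ifs with h
  · exact ⟨(QAVC.Cdet_le_Crand N).antisymm (QAVC.Crand_le_Cdet hN h),
      (QAVC.Qdet_le_Qrand N).antisymm (QAVC.Qrand_le_Qdet hN h)⟩
  · have h0 : QAVC.Cdet N = 0 := le_antisymm (not_lt.1 h) (QAVC.Cdet_nonneg N)
    exact ⟨h0, le_antisymm ((QAVC.Qdet_le_Cdet hN).trans h0.le) (QAVC.Qdet_nonneg hN)⟩
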